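/- Fix $\gamma>\tfrac12$ and $\epsilon'\in(0,2\gamma-1)$. For each $N$ let $M^N$ be the $N\times N$ block diagonal matrix with Jordan blocks $B^1,\dots,B^{\ell}$, $\ell=\ell(N)$, where $B^i$ has dimension $a_i\log N$ (a positive integer; $a_i=a_i(N)$), $\sum_{i=1}^{\ell} a_i\log N=N$, eigenvalue $c_i=c_i(N)\in\mathbb C$ on the diagonal and $1$ on the superdiagonal. Let $G^N$ be an $N\times N$ random matrix with i.i.d. real standard normal entries, and let $L_N=\frac1N\sum_{j=1}^N\delta_{\lambda_j}$ be the empirical measure of the eigenvalues $\lambda_j$ of $M^N+N^{-\gamma}G^N$. Let $m_{c,r}$ be the uniform probability measure on the circle with centre $c$ and radius $r$, put $r_i=\exp((-\gamma+\tfrac12)/a_i)$ and $$\mu_N=\sum_{i=1}^{\ell}\frac{a_i\log N}{N}\,m_{c_i,r_i},\qquad \mathcal V_N=\Bigl\{z\in\mathbb C:\ \min\bigl(a_i\log N,\ \bigl|1-|z-c_i|^2\bigr|^{-1}\bigr)<N^{2\gamma-1-\epsilon'}\ \text{ for all } 1\le i\le\ell\Bigr\},$$ where $0^{-1}=\infty$.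 For a compactly supported probability measure $\rho$ on $\mathbb C$ write $U_\rho(z)=\int\log|z-x|\,d\rho(x)\in[-\infty,\infty)$. Assume $\ell(N)=o(N)$ as $N\to\infty$, and let $z=z_N\in\mathbb C$ (for instance a fixed point $z$) satisfy $z\in\mathcal V_N$ for all sufficiently large $N$. Then for every $\delta>0$, $$\lim_{N\to\infty}\mathbb P\bigl[\,U_{L_N}(z)\le U_{\mu_N}(z)-\delta\,\bigr]=0 .$$ -/

import Mathlib

open MeasureTheory ProbabilityTheory Filter Topology Asymptotics
open scoped ENNReal

noncomputable section

/-- The `d × d` Jordan block with eigenvalue `c`: `c` on the diagonal, `1` on the superdiagonal. -/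
def jordanBlock (d : ℕ) (c : ℂ) : Matrix (Fin d) (Fin d) ℂ :=
  Matrix.of fun i j => if i = j then c else if (i : ℕ) + 1 = (j : ℕ) then 1 else 0

/-- The `N × N` block diagonal matrix with Jordan blocks `B¹, …, B^ℓ` in this order; the dimensions
of the blocks (positive integers with sum `N`) are the parts of the composition `b` of `N`, so
`ℓ = b.length`, and `c i` is the eigenvalue of the `i`-th block. -/
def jordanMatrix {N : ℕ} (b : Composition N) (c : Fin b.length → ℂ) :
    Matrix (Fin N) (Fin N) ℂ :=
  Matrix.reindex b.blocksFinEquiv b.blocksFinEquiv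
    (Matrix.blockDiagonal' fun i => jordanBlock (b.blocksFun i) (c i))

/-- The numbers `a_i`, for which the `i`-th block has dimension `a_i log N`. -/
def blockRatio {N : ℕ} (b : Composition N) (i : Fin b.length) : ℝ :=
  (b.blocksFun i : ℝ) / Real.log N

/-- The radii `r_i = exp ((-γ + 1/2) / a_i)`. -/
def blockRadius {N : ℕ} (γ : ℝ) (b : Composition N) (i : Fin b.length) : ℝ :=
  Real.exp ((-γ + 1 / 2) / blockRatio b i)

/-- The uniform probability measure `m_{c,r}` on the circle with centre `c` and radius `r`. -/
def uniformCircle (c : ℂ) (r : ℝ) : Measure ℂ :=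
  Measure.map (circleMap c r)
    ((ENNReal.ofReal (2 * Real.pi))⁻¹ • volume.restrict (Set.Ioc 0 (2 * Real.pi)))

/-- The measure `μ_N = ∑ i, (a_i log N / N) m_{c_i, r_i}`. -/
def circleMixture {N : ℕ} (γ : ℝ) (b : Composition N) (c : Fin b.length → ℂ) : Measure ℂ :=
  ∑ i, ((b.blocksFun i : ℝ≥0∞) / (N : ℝ≥0∞)) • uniformCircle (c i) (blockRadius γ b i)

/-- The empirical spectral measure of an `N × N` matrix (eigenvalues with multiplicity). -/
def empiricalSpectralMeasure {N : ℕ} (A : Matrix (Fin N) (Fin N) ℂ) : Measure ℂ :=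
  (N : ℝ≥0∞)⁻¹ • (A.charpoly.roots.map fun w => Measure.dirac w).sum

/-- The logarithmic potential `U_ρ(z) = ∫ log |z - x| dρ(x)`, as an extended real number: the
integral of the positive part minus the integral of the negative part, with `log 0 = -∞`. -/
def logPotential (ρ : Measure ℂ) (z : ℂ) : EReal :=
  ((∫⁻ x, (ENNReal.log ‖z - x‖ₑ).toENNReal ∂ρ : ℝ≥0∞) : EReal) -
    ((∫⁻ x, (-ENNReal.log ‖z - x‖ₑ).toENNReal ∂ρ : ℝ≥0∞) : EReal)

/-- The set `𝒱_N(ε)` of all `z` with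
`min (a_i log N, |1 - |z - c_i|²|⁻¹) < N ^ (2γ - 1 - ε)` for every block `i`. The inverse is
taken in `[0, ∞]`, so it is `∞` if `|z - c_i| = 1`. -/
def stableSet {N : ℕ} (γ ε : ℝ) (b : Composition N) (c : Fin b.length → ℂ) : Set ℂ :=
  {z | ∀ i, min (b.blocksFun i : ℝ≥0∞) (ENNReal.ofReal |1 - ‖z - c i‖ ^ 2|)⁻¹ <
    ENNReal.ofReal ((N : ℝ) ^ (2 * γ - 1 - ε))}

/-- The perturbed matrix `M + N^{-γ} G`, for a real noise matrix `G`. -/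
def perturbedMatrix {N : ℕ} (γ : ℝ) (M : Matrix (Fin N) (Fin N) ℂ)
    (G : Matrix (Fin N) (Fin N) ℝ) : Matrix (Fin N) (Fin N) ℂ :=
  M + (((N : ℝ) ^ (-γ) : ℝ) : ℂ) • G.map Complex.ofReal

/-- `G` is a random matrix whose entries are i.i.d. (real) standard normal variables. -/
def IsStandardGaussianMatrix {Ω : Type*} [MeasurableSpace Ω] (P : Measure Ω) {N : ℕ}
    (G : Ω → Matrix (Fin N) (Fin N) ℝ) : Prop :=
  iIndepFun (fun (p : Fin N × Fin N) ω => G ω p.1 p.2) P ∧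
    ∀ i j, HasLaw (fun ω => G ω i j) (gaussianReal 0 1) P

end

/-!
Put `σ = N ^ (-γ)`, `τ = N ^ (1/2 - γ)` and expand `det (M - z + σ G)` in minors of `M - z`. From
each Jordan block whose smallest singular value is negligible with respect to the noise
(`‖w‖ < 1` and `‖w‖ ^ n < n τ`, for a block of size `n` with eigenvalue `w = c i - z`), delete the
last row and the first column; let `D` be the remaining submatrix and `s ≤ ℓ` the number of deleted
rows. On the stable set the inverse `X` of `D` satisfies `σ² ‖X‖² ≤ N ^ (-ε) + ℓ / N` in the
Hilbert–Schmidt norm, so a second moment computation shows that the noise changes `det D` only by a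
factor close to `1`. Given the rows of this perturbed minor, the full determinant is multilinear in
the other `s` Gaussian rows, and integrating out one row at a time bounds a moment of order `-1/2`
with a loss of `3 ^ s = exp (o(N))`: the determinant is unlikely to be exponentially smaller than
`σ ^ s √(s!) |det D|`. By Jensen's formula, `exp (N U_μ(z))` is the product of `max τ (‖w‖ ^ n)`
over the blocks, which exceeds `σ ^ s √(s!) |det D|` at most by a factor `exp (o(N))`.
-/

section GaussianMoments

variable {ι R : Type*} [Fintype ι] [Fintype R]

/-- The law on `ι → ℝ` of a family of independent standard normal variables. -/
noncomputable abbrev stdGaussianPi (ι : Type*) [Fintype ι] : Measure (ι → ℝ) :=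
  Measure.pi fun _ => gaussianReal 0 1

lemma hasLaw_sum_gaussianReal {ι Ω : Type*} [MeasurableSpace Ω] {P : Measure Ω}
    [IsProbabilityMeasure P] {X : ι → Ω → ℝ} {m : ι → ℝ} {v : ι → NNReal}
    (hind : iIndepFun X P) (hm : ∀ i, Measurable (X i))
    (hX : ∀ i, HasLaw (X i) (gaussianReal (m i) (v i)) P) (s : Finset ι) :
    HasLaw (∑ i ∈ s, X i) (gaussianReal (∑ i ∈ s, m i) (∑ i ∈ s, v i)) P := by
  classical
  induction s using Finset.induction_on with
  | empty => exact ⟨by fun_prop, by simp [Pi.zero_def, Measure.map_const]⟩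
  | insert i s hi ih =>
    refine ⟨by fun_prop, ?_⟩
    rw [Finset.sum_insert hi, Finset.sum_insert hi, Finset.sum_insert hi]
    exact gaussianReal_add_gaussianReal_of_indepFun
      (hind.indepFun_finsetSum_of_notMem hm hi).symm (hX i).map_eq ih.map_eq

lemma hasLaw_add_sum_mul (y : ℝ) (a : ι → ℝ) :
    HasLaw (fun g => y + ∑ i, a i * g i) (gaussianReal y (∑ i, ‖a i‖₊ ^ 2)) (stdGaussianPi ι) := by
  have hlaw (i : ι) :
      HasLaw (fun g : ι → ℝ => a i * g i) (gaussianReal 0 (‖a i‖₊ ^ 2)) (stdGaussianPi ι) := by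
    have hvar : (.mk (a i ^ 2) (sq_nonneg _) * 1 : NNReal) = ‖a i‖₊ ^ 2 := by ext; simp
    simpa only [mul_zero, hvar] using gaussianReal_const_mul
      (measurePreserving_eval (fun _ : ι => gaussianReal 0 1) i).hasLaw (a i)
  have hind : iIndepFun (fun i (g : ι → ℝ) => a i * g i) (stdGaussianPi ι) :=
    iIndepFun_pi (X := fun i x => a i * x) fun i => by fun_prop
  have hsum := hasLaw_sum_gaussianReal hind (fun i => by fun_prop) hlaw Finset.univ
  simpa [Finset.sum_fn] using gaussianReal_const_add hsum y

lemma lintegral_enorm_sq_gaussianReal (μ : ℝ) (v : NNReal) :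
    ∫⁻ x, ‖x‖ₑ ^ 2 ∂(gaussianReal μ v) = ‖μ‖ₑ ^ 2 + v := by
  have hL2 : MemLp (fun x : ℝ => x) 2 (gaussianReal μ v) := memLp_id_gaussianReal 2
  have hsecond : ∫ x, x ^ 2 ∂(gaussianReal μ v) = μ ^ 2 + v := by
    have hvar := variance_eq_sub hL2
    rw [variance_fun_id_gaussianReal, integral_id_gaussianReal] at hvar
    rw [hvar]
    simp
  have henorm (x : ℝ) : ‖x‖ₑ ^ 2 = ENNReal.ofReal (x ^ 2) := by
    rw [← sq_abs, ENNReal.ofReal_pow (abs_nonneg x), ← Real.enorm_eq_ofReal_abs]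
  simp_rw [henorm]
  rw [← ofReal_integral_eq_lintegral_ofReal hL2.integrable_sq (ae_of_all _ sq_nonneg), hsecond,
    ENNReal.ofReal_add (sq_nonneg μ) v.coe_nonneg, ENNReal.ofReal_coe_nnreal]

lemma enorm_sq_eq_re_add_im (w : ℂ) : ‖w‖ₑ ^ 2 = ‖w.re‖ₑ ^ 2 + ‖w.im‖ₑ ^ 2 := by
  simp only [← ofReal_norm, ← ENNReal.ofReal_pow (norm_nonneg _)]
  rw [← ENNReal.ofReal_add (by positivity) (by positivity), Complex.sq_norm, Complex.normSq_apply,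
    Real.norm_eq_abs, Real.norm_eq_abs, sq_abs, sq_abs, sq, sq]

lemma lintegral_enorm_sq_add_sum_mul (y : ℂ) (a : ι → ℂ) :
    ∫⁻ g, ‖y + ∑ i, a i * (g i : ℂ)‖ₑ ^ 2 ∂(stdGaussianPi ι) =
      ‖y‖ₑ ^ 2 + ∑ i, ‖a i‖ₑ ^ 2 := by
  have hreal (y : ℝ) (a : ι → ℝ) : ∫⁻ g, ‖y + ∑ i, a i * g i‖ₑ ^ 2 ∂(stdGaussianPi ι) =
      ‖y‖ₑ ^ 2 + ∑ i, ‖a i‖ₑ ^ 2 := by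
    rw [(hasLaw_add_sum_mul y a).lintegral_comp (f := fun x => ‖x‖ₑ ^ 2) (by fun_prop),
      lintegral_enorm_sq_gaussianReal]
    simp [enorm_eq_nnnorm]
  simp_rw [enorm_sq_eq_re_add_im, Complex.add_re, Complex.add_im, Complex.re_sum, Complex.im_sum,
    Complex.re_mul_ofReal, Complex.im_mul_ofReal]
  rw [lintegral_add_left (by fun_prop), hreal, hreal, Finset.sum_add_distrib, add_add_add_comm]

lemma ennreal_rpow_le_rpow_of_nonpos {x y : ℝ≥0∞} {p : ℝ} (hp : p ≤ 0) (h : x ≤ y) :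
    y ^ p ≤ x ^ p := by
  rw [← neg_neg p, ENNReal.rpow_neg y, ENNReal.rpow_neg x, ENNReal.inv_le_inv]
  exact ENNReal.rpow_le_rpow h (neg_nonneg.2 hp)

lemma setLIntegral_Ioc_enorm_rpow_neg_half {ρ : ℝ} (hρ : 0 ≤ ρ) :
    ∫⁻ x in Set.Ioc 0 ρ, ‖x‖ₑ ^ (-(1 / 2) : ℝ) = ENNReal.ofReal (2 * √ρ) := by
  have hint : ∫ x in (0 : ℝ)..ρ, x ^ (-(1 / 2) : ℝ) = 2 * √ρ := by
    rw [integral_rpow (by norm_num), Real.sqrt_eq_rpow]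
    norm_num
    ring
  rw [← hint, intervalIntegral.integral_of_le hρ, ofReal_integral_eq_lintegral_ofReal]
  · refine setLIntegral_congr_fun measurableSet_Ioc fun x hx => ?_
    rw [Real.enorm_eq_ofReal hx.1.le, ENNReal.ofReal_rpow_of_pos hx.1]
  · exact (intervalIntegrable_iff_integrableOn_Ioc_of_le hρ).1
      (intervalIntegral.intervalIntegrable_rpow' (by norm_num))
  · exact ae_restrict_of_forall_mem measurableSet_Ioc fun x hx => Real.rpow_nonneg hx.1.le _

lemma setLIntegral_Ioo_enorm_rpow_neg_half_le {ρ : ℝ} (hρ : 0 ≤ ρ) :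
    ∫⁻ x in Set.Ioo (-ρ) ρ, ‖x‖ₑ ^ (-(1 / 2) : ℝ) ≤ ENNReal.ofReal (4 * √ρ) := by
  have hneg : ∫⁻ x in Set.Ico (-ρ) 0, ‖x‖ₑ ^ (-(1 / 2) : ℝ) =
      ∫⁻ x in Set.Ioc 0 ρ, ‖x‖ₑ ^ (-(1 / 2) : ℝ) := by
    simpa using (Measure.measurePreserving_neg (volume : Measure ℝ)).setLIntegral_comp_preimage_emb
      (MeasurableEquiv.neg ℝ).measurableEmbedding (fun x => ‖x‖ₑ ^ (-(1 / 2) : ℝ)) (Set.Ioc 0 ρ)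
  calc ∫⁻ x in Set.Ioo (-ρ) ρ, ‖x‖ₑ ^ (-(1 / 2) : ℝ)
      ≤ ∫⁻ x in Set.Icc (-ρ) 0 ∪ Set.Ioc 0 ρ, ‖x‖ₑ ^ (-(1 / 2) : ℝ) :=
        lintegral_mono_set fun x hx => (le_or_gt x 0).imp (⟨hx.1.le, ·⟩) (⟨·, hx.2.le⟩)
    _ ≤ (∫⁻ x in Set.Icc (-ρ) 0, ‖x‖ₑ ^ (-(1 / 2) : ℝ)) +
          ∫⁻ x in Set.Ioc 0 ρ, ‖x‖ₑ ^ (-(1 / 2) : ℝ) := lintegral_union_le _ _ _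
    _ = ENNReal.ofReal (4 * √ρ) := by
        rw [setLIntegral_congr Ico_ae_eq_Icc.symm, hneg, setLIntegral_Ioc_enorm_rpow_neg_half hρ,
          ← ENNReal.ofReal_add (by positivity) (by positivity)]
        ring_nf

lemma gaussianPDF_le (μ : ℝ) (v : NNReal) (x : ℝ) :
    gaussianPDF μ v x ≤ ENNReal.ofReal (√(2 * Real.pi * v))⁻¹ := by
  refine ENNReal.ofReal_le_ofReal (mul_le_of_le_one_right (by positivity) ?_)
  rw [Real.exp_le_one_iff, neg_div, neg_nonpos]
  positivity

lemma setLIntegral_Ioo_enorm_rpow_neg_half_gaussianReal_le (μ : ℝ) {v : NNReal} (hv : v ≠ 0) :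
    ∫⁻ x in Set.Ioo (-√v) √v, ‖x‖ₑ ^ (-(1 / 2) : ℝ) ∂(gaussianReal μ v) ≤
      2 * (v : ℝ≥0∞) ^ (-(1 / 4) : ℝ) := by
  have hv0 : (0 : ℝ) < v := by positivity
  rw [gaussianReal_of_var_ne_zero _ hv, setLIntegral_withDensity_eq_setLIntegral_mul _
    (measurable_gaussianPDF μ v) (by fun_prop) measurableSet_Ioo]
  calc ∫⁻ x in Set.Ioo (-√v) √v, (gaussianPDF μ v * fun x : ℝ => ‖x‖ₑ ^ (-(1 / 2) : ℝ)) x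
      ≤ ∫⁻ x in Set.Ioo (-√v) √v, ENNReal.ofReal (√(2 * Real.pi * v))⁻¹ *
          ‖x‖ₑ ^ (-(1 / 2) : ℝ) := lintegral_mono fun x => mul_le_mul_left (gaussianPDF_le μ v x) _
    _ ≤ ENNReal.ofReal (√(2 * Real.pi * v))⁻¹ * ENNReal.ofReal (4 * √√v) := by
        rw [lintegral_const_mul _ (by fun_prop)]
        gcongr
        exact setLIntegral_Ioo_enorm_rpow_neg_half_le (Real.sqrt_nonneg _)
    _ ≤ ENNReal.ofReal (2 * (v : ℝ) ^ (-(1 / 4) : ℝ)) := by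
        rw [← ENNReal.ofReal_mul (by positivity)]
        refine ENNReal.ofReal_le_ofReal ?_
        have hsqrt : 2 * √v ≤ √(2 * Real.pi * v) := by
          rw [Real.le_sqrt (by positivity) (by positivity), mul_pow, Real.sq_sqrt hv0.le]
          nlinarith [Real.pi_gt_three]
        have hpow : √√(v : ℝ) = √v * (v : ℝ) ^ (-(1 / 4) : ℝ) := by
          rw [Real.sqrt_eq_rpow (√v), Real.sqrt_eq_rpow v, ← Real.rpow_mul hv0.le,
            ← Real.rpow_add hv0]
          norm_num
        rw [inv_mul_le_iff₀ (by positivity), hpow]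
        calc 4 * (√v * (v : ℝ) ^ (-(1 / 4) : ℝ))
            = 2 * √v * (2 * (v : ℝ) ^ (-(1 / 4) : ℝ)) := by ring
          _ ≤ √(2 * Real.pi * v) * (2 * (v : ℝ) ^ (-(1 / 4) : ℝ)) := by gcongr
    _ = 2 * (v : ℝ≥0∞) ^ (-(1 / 4) : ℝ) := by
        rw [ENNReal.ofReal_mul zero_le_two, ← ENNReal.ofReal_rpow_of_pos hv0,
          ENNReal.ofReal_coe_nnreal, ENNReal.ofReal_ofNat]

lemma lintegral_enorm_rpow_neg_half_gaussianReal_le (μ : ℝ) (v : NNReal) :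
    ∫⁻ x, ‖x‖ₑ ^ (-(1 / 2) : ℝ) ∂(gaussianReal μ v) ≤ 3 * (v : ℝ≥0∞) ^ (-(1 / 4) : ℝ) := by
  rcases eq_or_ne v 0 with rfl | hv
  · simp
  have hfar : ∫⁻ x in (Set.Ioo (-√v) √v)ᶜ, ‖x‖ₑ ^ (-(1 / 2) : ℝ) ∂(gaussianReal μ v) ≤
      (v : ℝ≥0∞) ^ (-(1 / 4) : ℝ) := by
    calc ∫⁻ x in (Set.Ioo (-√v) √v)ᶜ, ‖x‖ₑ ^ (-(1 / 2) : ℝ) ∂(gaussianReal μ v)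
        ≤ ∫⁻ _ in (Set.Ioo (-√v) √v)ᶜ, (v : ℝ≥0∞) ^ (-(1 / 4) : ℝ) ∂(gaussianReal μ v) := by
          refine setLIntegral_mono (by fun_prop) fun x hx => ?_
          have hx' : ENNReal.ofReal √v ≤ ‖x‖ₑ := by
            rw [Real.enorm_eq_ofReal_abs]
            exact ENNReal.ofReal_le_ofReal (not_lt.1 fun h => hx (abs_lt.1 h))
          refine (ennreal_rpow_le_rpow_of_nonpos (by norm_num) hx').trans_eq ?_
          rw [Real.sqrt_eq_rpow, ← ENNReal.ofReal_rpow_of_nonneg v.coe_nonneg (by norm_num),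
            ENNReal.ofReal_coe_nnreal, ← ENNReal.rpow_mul]
          norm_num
      _ ≤ (v : ℝ≥0∞) ^ (-(1 / 4) : ℝ) := by
          rw [setLIntegral_const]
          exact mul_le_of_le_one_right' prob_le_one
  rw [← lintegral_add_compl _ (measurableSet_Ioo (a := -√v) (b := √v))]
  calc _ ≤ 2 * (v : ℝ≥0∞) ^ (-(1 / 4) : ℝ) + (v : ℝ≥0∞) ^ (-(1 / 4) : ℝ) :=
        add_le_add (setLIntegral_Ioo_enorm_rpow_neg_half_gaussianReal_le μ hv) hfar
    _ = 3 * (v : ℝ≥0∞) ^ (-(1 / 4) : ℝ) := by ring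

lemma ennreal_sq_rpow_neg_quarter (x : ℝ≥0∞) : (x ^ 2) ^ (-(1 / 4) : ℝ) = x ^ (-(1 / 2) : ℝ) := by
  rw [← ENNReal.rpow_natCast, ← ENNReal.rpow_mul]
  norm_num

lemma lintegral_enorm_sq_add_sum_mul_rpow_neg_quarter_le (y : ℝ) (a : ι → ℝ) :
    ∫⁻ g, (‖y + ∑ i, a i * g i‖ₑ ^ 2) ^ (-(1 / 4) : ℝ) ∂(stdGaussianPi ι) ≤
      3 * (∑ i, ‖a i‖ₑ ^ 2) ^ (-(1 / 4) : ℝ) := by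
  simp_rw [ennreal_sq_rpow_neg_quarter]
  rw [(hasLaw_add_sum_mul y a).lintegral_comp (f := fun x => ‖x‖ₑ ^ (-(1 / 2) : ℝ)) (by fun_prop)]
  have hmoment := lintegral_enorm_rpow_neg_half_gaussianReal_le y (∑ i, ‖a i‖₊ ^ 2)
  push_cast at hmoment
  simpa only [enorm_eq_nnnorm] using hmoment

lemma radon_inequality {s : ℝ} (hs : 0 < s) (V X : R → ℝ≥0∞) :
    (∑ r, X r) ^ (-s) * (∑ r, V r) ^ (1 + s) ≤ ∑ r, X r ^ (-s) * V r ^ (1 + s) := by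
  have hs' : 0 < 1 + s := by linarith
  by_cases htop : ∃ r, X r = ⊤
  · rw [ENNReal.sum_eq_top.2 (by simpa using htop), ENNReal.top_rpow_of_neg (by linarith), zero_mul]
    exact zero_le
  by_cases hzero : ∃ r, X r = 0 ∧ V r ≠ 0
  · obtain ⟨r, hX, hV⟩ := hzero
    have hr : X r ^ (-s) * V r ^ (1 + s) = ⊤ := by
      rw [hX, ENNReal.zero_rpow_of_neg (by linarith), ENNReal.top_mul]
      simpa [hs', hs'.le] using hV
    exact le_top.trans_eq (ENNReal.sum_eq_top.2 ⟨r, Finset.mem_univ r, hr⟩).symm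
  push Not at htop hzero
  have hV (r : R) : X r * (V r / X r) = V r := by
    by_cases hX : X r = 0
    · simp [hX, hzero r hX]
    · exact ENNReal.mul_div_cancel hX (htop r)
  have hVpow (r : R) : X r * (V r / X r) ^ (1 + s) = X r ^ (-s) * V r ^ (1 + s) := by
    by_cases hX : X r = 0
    · simp [hX, hzero r hX, hs']
    · have hsplit : X r ^ (1 + s) = X r * X r ^ s := by
        rw [ENNReal.rpow_add 1 s hX (htop r), ENNReal.rpow_one]
      rw [ENNReal.div_rpow_of_nonneg _ _ hs'.le, hsplit, ENNReal.rpow_neg, div_eq_mul_inv,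
        ENNReal.mul_inv (Or.inl hX) (Or.inl (htop r)), mul_left_comm (X r), ← mul_assoc (X r),
        ENNReal.mul_inv_cancel hX (htop r), one_mul, mul_comm]
  have hholder := ENNReal.inner_le_weight_mul_Lp_of_nonneg Finset.univ (by linarith : 1 ≤ 1 + s) X
    fun r => V r / X r
  simp only [hV, hVpow] at hholder
  set S := ∑ r, X r
  set B := ∑ r, X r ^ (-s) * V r ^ (1 + s)
  have hpow : (∑ r, V r) ^ (1 + s) ≤ S ^ s * B := by
    refine (ENNReal.rpow_le_rpow hholder hs'.le).trans_eq ?_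
    rw [ENNReal.mul_rpow_of_nonneg _ _ hs'.le, ← ENNReal.rpow_mul, ← ENNReal.rpow_mul,
      inv_mul_cancel₀ hs'.ne', ENNReal.rpow_one]
    congr 2
    field_simp
    ring
  rw [ENNReal.rpow_neg, mul_comm, ← div_eq_mul_inv]
  exact ENNReal.div_le_of_le_mul' hpow

lemma lintegral_sum_enorm_sq_rpow_neg_quarter_le (y : R → ℝ) (a : R → ι → ℝ) :
    ∫⁻ g, (∑ r, ‖y r + ∑ i, a r i * g i‖ₑ ^ 2) ^ (-(1 / 4) : ℝ) ∂(stdGaussianPi ι) ≤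
      3 * (∑ r, ∑ i, ‖a r i‖ₑ ^ 2) ^ (-(1 / 4) : ℝ) := by
  set V : R → ℝ≥0∞ := fun r => ∑ i, ‖a r i‖ₑ ^ 2
  set X : R → (ι → ℝ) → ℝ≥0∞ := fun r g => ‖y r + ∑ i, a r i * g i‖ₑ ^ 2
  set W : ℝ≥0∞ := ∑ r, V r
  have hVtop (r : R) : V r ≠ ⊤ := by simp [V, ENNReal.sum_eq_top]
  have hWtop : W ≠ ⊤ := by simp [W, ENNReal.sum_eq_top, hVtop]
  by_cases hW0 : W = 0
  · simp [W, hW0]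
  have hterm (r : R) :
      (∫⁻ g, X r g ^ (-(1 / 4) : ℝ) ∂(stdGaussianPi ι)) * V r ^ (1 + 1 / 4 : ℝ) ≤ 3 * V r := by
    by_cases hV0 : V r = 0
    · rw [hV0, ENNReal.zero_rpow_of_pos (by norm_num), mul_zero]
      exact zero_le
    calc _ ≤ 3 * V r ^ (-(1 / 4) : ℝ) * V r ^ (1 + 1 / 4 : ℝ) := by
          gcongr
          exact lintegral_enorm_sq_add_sum_mul_rpow_neg_quarter_le (y r) (a r)
      _ = 3 * V r := by
          rw [mul_assoc, ← ENNReal.rpow_add _ _ hV0 (hVtop r)]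
          norm_num
  -- The summands share the vector `g`, so they are dependent; Radon's inequality bounds the
  -- integrand by a weighted sum over `r` and only the marginal laws remain.
  have hsum : (∫⁻ g, (∑ r, X r g) ^ (-(1 / 4) : ℝ) ∂(stdGaussianPi ι)) * W ^ (1 + 1 / 4 : ℝ) ≤
      3 * W := by
    calc _ = ∫⁻ g, (∑ r, X r g) ^ (-(1 / 4) : ℝ) * W ^ (1 + 1 / 4 : ℝ) ∂(stdGaussianPi ι) :=
          (lintegral_mul_const _ (by fun_prop)).symm
      _ ≤ ∫⁻ g, ∑ r, X r g ^ (-(1 / 4) : ℝ) * V r ^ (1 + 1 / 4 : ℝ) ∂(stdGaussianPi ι) :=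
          lintegral_mono fun g => radon_inequality (by norm_num) V fun r => X r g
      _ = ∑ r, (∫⁻ g, X r g ^ (-(1 / 4) : ℝ) ∂(stdGaussianPi ι)) * V r ^ (1 + 1 / 4 : ℝ) := by
          rw [lintegral_finsetSum _ fun r _ => by fun_prop]
          exact Finset.sum_congr rfl fun r _ => lintegral_mul_const _ (by fun_prop)
      _ ≤ 3 * W := by
          rw [Finset.mul_sum]
          exact Finset.sum_le_sum fun r _ => hterm r
  refine (ENNReal.le_div_iff_mul_le (Or.inl (by simp [hW0, hWtop])) (Or.inl (by
    simp [hW0, hWtop]))).2 hsum |>.trans_eq ?_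
  rw [mul_div_assoc, ENNReal.rpow_add 1 _ hW0 hWtop, ENNReal.rpow_one, ENNReal.rpow_neg,
    ENNReal.div_eq_inv_mul, ENNReal.mul_inv (Or.inl hW0) (Or.inl hWtop), mul_right_comm,
    ENNReal.inv_mul_cancel hW0 hWtop, one_mul]

lemma lintegral_sum_enorm_sq_rpow_neg_quarter_le_complex (y : R → ℂ) (a : R → ι → ℂ) :
    ∫⁻ g, (∑ r, ‖y r + ∑ i, a r i * (g i : ℂ)‖ₑ ^ 2) ^ (-(1 / 4) : ℝ) ∂(stdGaussianPi ι) ≤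
      3 * (∑ r, ∑ i, ‖a r i‖ₑ ^ 2) ^ (-(1 / 4) : ℝ) := by
  simpa [enorm_sq_eq_re_add_im, Finset.sum_add_distrib, Fintype.sum_sum_type] using
    lintegral_sum_enorm_sq_rpow_neg_quarter_le (Sum.elim (fun r => (y r).re) fun r => (y r).im)
      (Sum.elim (fun r i => (a r i).re) fun r i => (a r i).im)

end GaussianMoments

section GaussianRows

universe u

variable {ι : Type u} [Fintype ι] {m : ℕ}

lemma lintegral_pi_fin_succ_le {α : Type*} [MeasurableSpace α] (μ : Measure α) [SigmaFinite μ]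
    (F : (Fin (m + 1) → α) → ℝ≥0∞) :
    ∫⁻ g, F g ∂(Measure.pi fun _ => μ) ≤
      ∫⁻ h, ∫⁻ x, F (Fin.cons x h) ∂μ ∂(Measure.pi fun _ : Fin m => μ) := by
  have hcons := (measurePreserving_piFinSuccAbove (fun _ : Fin (m + 1) => μ) 0).symm.comp
    Measure.measurePreserving_swap
  rw [← hcons.lintegral_comp_emb ((MeasurableEquiv.measurableEmbedding _).comp
    MeasurableEquiv.prodComm.measurableEmbedding) F]
  refine (lintegral_prod_le _).trans_eq ?_
  simp [MeasurableEquiv.piFinSuccAbove_symm_apply, Fin.insertNthEquiv]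

/-- The rows `b j + g j`: the random complex rows of this development are fixed complex rows `b`
shifted by real Gaussian rows `g`. -/
def realShift {κ ι : Type*} (b : κ → ι → ℂ) (g : κ → ι → ℝ) : κ → ι → ℂ :=
  fun j i => b j i + (g j i : ℂ)

lemma map_realShift_cons [DecidableEq ι]
    (f : MultilinearMap ℂ (fun _ : Fin (m + 1) => ι → ℂ) ℂ) (b : Fin (m + 1) → ι → ℂ)
    (x : ι → ℝ) (h : Fin m → ι → ℝ) :
    f (realShift b (Fin.cons x h)) = f.curryLeft (b 0) (realShift (Fin.tail b) h) +
      ∑ i, f.curryLeft (Pi.single i 1) (realShift (Fin.tail b) h) * (x i : ℂ) := by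
  have hcons : realShift b (Fin.cons x h) =
      Fin.cons (b 0 + ∑ i, (x i : ℂ) • (Pi.single i 1 : ι → ℂ)) (realShift (Fin.tail b) h) := by
    ext j i
    refine Fin.cases ?_ (fun j => ?_) j
    · simp [realShift, Finset.sum_apply, Pi.single_apply]
    · simp [realShift, Fin.tail]
  rw [hcons, ← MultilinearMap.curryLeft_apply, map_add, map_sum]
  simp [mul_comm]

lemma multilinearMap_apply_eq_sum_single [DecidableEq ι]
    (f : MultilinearMap ℂ (fun _ : Fin m => ι → ℂ) ℂ) (v : Fin m → ι → ℂ) :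
    f v = ∑ φ : Fin m → ι, (∏ j, v j (φ j)) * f fun j => Pi.single (φ j) 1 := by
  have hv : v = fun j => ∑ i, v j i • (Pi.single i 1 : ι → ℂ) := by
    ext j i
    simp [Finset.sum_apply, Pi.single_apply]
  conv_lhs => rw [hv, MultilinearMap.map_sum]
  simp [MultilinearMap.map_smul_univ]

lemma measurable_multilinearMap_realShift {κ : Type*} [Finite κ]
    (f : MultilinearMap ℂ (fun _ : Fin m => κ → ℂ) ℂ) (b : Fin m → κ → ℂ) :
    Measurable fun g : Fin m → κ → ℝ => f (realShift b g) := by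
  classical
  have := Fintype.ofFinite κ
  rw [funext fun g => multilinearMap_apply_eq_sum_single f (realShift b g)]
  unfold realShift
  fun_prop

lemma lintegral_sum_multilinearMap_rpow_neg_quarter_le [DecidableEq ι] {R : Type u} [Fintype R]
    (f : R → MultilinearMap ℂ (fun _ : Fin m => ι → ℂ) ℂ) (b : Fin m → ι → ℂ) :
    ∫⁻ g, (∑ r, ‖f r (realShift b g)‖ₑ ^ 2) ^ (-(1 / 4) : ℝ)
        ∂(Measure.pi fun _ : Fin m => stdGaussianPi ι) ≤
      3 ^ m * (∑ r, ∑ φ : Fin m → ι, ‖f r fun j => Pi.single (φ j) 1‖ₑ ^ 2) ^ (-(1 / 4) : ℝ) := by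
  induction m generalizing R with
  | zero =>
    have hconst (r : R) (u : Fin 0 → ι → ℂ) : f r u = f r 0 :=
      congrArg (f r) (Subsingleton.elim _ _)
    simp [hconst]
  | succ m ih =>
    have hfirst (h : Fin m → ι → ℝ) :
        ∫⁻ x, (∑ r, ‖f r (realShift b (Fin.cons x h))‖ₑ ^ 2) ^ (-(1 / 4) : ℝ) ∂(stdGaussianPi ι) ≤
          3 * (∑ q : R × ι, ‖(f q.1).curryLeft (Pi.single q.2 1)
            (realShift (Fin.tail b) h)‖ₑ ^ 2) ^ (-(1 / 4) : ℝ) := by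
      simp_rw [map_realShift_cons]
      refine (lintegral_sum_enorm_sq_rpow_neg_quarter_le_complex _ _).trans_eq ?_
      rw [Fintype.sum_prod_type]
    refine (lintegral_pi_fin_succ_le _ _).trans ((lintegral_mono hfirst).trans ?_)
    rw [lintegral_const_mul' _ _ (by norm_num), pow_succ', mul_assoc]
    gcongr
    refine (ih (fun q : R × ι => (f q.1).curryLeft (Pi.single q.2 1)) (Fin.tail b)).trans_eq ?_
    congr 2
    rw [Fintype.sum_prod_type]
    refine Finset.sum_congr rfl fun r _ => ?_
    rw [← (Fin.consEquiv fun _ : Fin (m + 1) => ι).sum_comp, Fintype.sum_prod_type]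
    refine Finset.sum_congr rfl fun i _ => Finset.sum_congr rfl fun φ _ => ?_
    rw [MultilinearMap.curryLeft_apply]
    congr 3
    ext j
    refine Fin.cases ?_ (fun j => ?_) j <;> simp [Fin.consEquiv]

lemma measure_multilinearMap_realShift_le [DecidableEq ι]
    (f : MultilinearMap ℂ (fun _ : Fin m => ι → ℂ) ℂ) (b : Fin m → ι → ℂ) {c θ : ℝ≥0∞}
    (hc0 : c ≠ 0) (hctop : c ≠ ⊤) (hθ0 : θ ≠ 0) (hθtop : θ ≠ ⊤)
    (hf : c ^ 2 ≤ ∑ φ : Fin m → ι, ‖f fun j => Pi.single (φ j) 1‖ₑ ^ 2) :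
    (Measure.pi fun _ : Fin m => stdGaussianPi ι) {g | ‖f (realShift b g)‖ₑ ≤ c * θ} ≤
      3 ^ m * θ ^ (1 / 2 : ℝ) := by
  have hmoment : ∫⁻ g, ‖f (realShift b g)‖ₑ ^ (-(1 / 2) : ℝ)
      ∂(Measure.pi fun _ : Fin m => stdGaussianPi ι) ≤ 3 ^ m * c ^ (-(1 / 2) : ℝ) := by
    have hneg := lintegral_sum_multilinearMap_rpow_neg_quarter_le (fun _ : PUnit.{u + 1} => f) b
    simp only [Finset.univ_unique, Finset.sum_singleton, ennreal_sq_rpow_neg_quarter] at hneg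
    rw [← ennreal_sq_rpow_neg_quarter c]
    exact hneg.trans (mul_le_mul_right (ennreal_rpow_le_rpow_of_nonpos (by norm_num) hf) _)
  calc _ ≤ (Measure.pi fun _ : Fin m => stdGaussianPi ι)
          {g | (c * θ) ^ (-(1 / 2) : ℝ) ≤ ‖f (realShift b g)‖ₑ ^ (-(1 / 2) : ℝ)} :=
        measure_mono fun g hg => ennreal_rpow_le_rpow_of_nonpos (by norm_num) hg
    _ ≤ (3 ^ m * c ^ (-(1 / 2) : ℝ)) / (c * θ) ^ (-(1 / 2) : ℝ) := by
        refine (meas_ge_le_lintegral_div ?_ ?_ ?_).trans (ENNReal.div_le_div_right hmoment _)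
        · exact ((measurable_multilinearMap_realShift f b).enorm.pow_const _).aemeasurable
        · simp [ENNReal.mul_eq_top, hc0, hctop, hθtop]
        · simp [hc0, hθ0]
    _ = 3 ^ m * θ ^ (1 / 2 : ℝ) := by
        rw [div_eq_mul_inv, ← ENNReal.rpow_neg, neg_neg,
          ENNReal.mul_rpow_of_nonneg _ _ (by norm_num),
          mul_assoc, ← mul_assoc (c ^ _), ← ENNReal.rpow_add _ _ hc0 hctop]
        norm_num

lemma lintegral_multilinearMap_sub_sq_le [DecidableEq ι]
    (f : MultilinearMap ℂ (fun _ : Fin m => ι → ℂ) ℂ) (b : Fin m → ι → ℂ) (c : ℂ) :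
    ∫⁻ g, ‖f (realShift b g) - c‖ₑ ^ 2 ∂(Measure.pi fun _ : Fin m => stdGaussianPi ι) ≤
      ∑ ψ : Fin m → Option ι, ‖(f fun j => (ψ j).elim (b j) fun i => Pi.single i 1) -
        if ψ = (fun _ => none) then c else 0‖ₑ ^ 2 := by
  induction m generalizing c with
  | zero =>
    have hconst (u : Fin 0 → ι → ℂ) : f u = f 0 := congrArg f (Subsingleton.elim _ _)
    have hnone (ψ : Fin 0 → Option ι) : ψ = fun _ => none := Subsingleton.elim _ _
    simp_rw [hconst, if_pos (hnone _)]
    simp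
  | succ m ih =>
    have hfirst (h : Fin m → ι → ℝ) :
        ∫⁻ x, ‖f (realShift b (Fin.cons x h)) - c‖ₑ ^ 2 ∂(stdGaussianPi ι) =
          ‖f.curryLeft (b 0) (realShift (Fin.tail b) h) - c‖ₑ ^ 2 +
            ∑ i, ‖f.curryLeft (Pi.single i 1) (realShift (Fin.tail b) h) - 0‖ₑ ^ 2 := by
      simp_rw [map_realShift_cons, add_sub_right_comm, sub_zero]
      exact lintegral_enorm_sq_add_sum_mul _ _
    have hmeas (v : ι → ℂ) (c : ℂ) : Measurable fun h : Fin m → ι → ℝ =>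
        ‖f.curryLeft v (realShift (Fin.tail b) h) - c‖ₑ ^ 2 :=
      ((measurable_multilinearMap_realShift _ _).sub_const c).enorm.pow_const 2
    have hcons (o : Option ι) (ψ : Fin m → Option ι) :
        (fun j => ((Fin.consEquiv fun _ : Fin (m + 1) => Option ι) (o, ψ) j).elim (b j)
          fun i => (Pi.single i 1 : ι → ℂ)) =
        Fin.cons (o.elim (b 0) fun i => Pi.single i 1)
          (fun j => (ψ j).elim (Fin.tail b j) fun i => Pi.single i 1) := by
      ext j
      refine Fin.cases ?_ (fun j => ?_) j <;> simp [Fin.consEquiv, Fin.tail]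
    have hnone (o : Option ι) (ψ : Fin m → Option ι) :
        ((Fin.consEquiv fun _ : Fin (m + 1) => Option ι) (o, ψ) = fun _ => none) ↔
          o = none ∧ ψ = fun _ => none := by
      simp [funext_iff, Fin.forall_fin_succ, Fin.consEquiv]
    refine (lintegral_pi_fin_succ_le _ _).trans ?_
    simp_rw [hfirst]
    rw [lintegral_add_left (hmeas _ _), lintegral_finsetSum _ fun i _ => hmeas _ _]
    refine (add_le_add (ih _ _ _) (Finset.sum_le_sum fun i _ => ih _ _ _)).trans_eq ?_
    rw [← (Fin.consEquiv fun _ : Fin (m + 1) => Option ι).sum_comp, Fintype.sum_prod_type,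
      Fintype.sum_option]
    simp_rw [hcons, hnone, MultilinearMap.curryLeft_apply]
    simp

end GaussianRows

section DeterminantExpansion

open ComplexOrder Matrix

variable {m n : Type*} [Fintype m]

lemma conjTranspose_mul_self_apply_self (A : Matrix m n ℂ) (k : n) :
    (Aᴴ * A) k k = ((∑ i, ‖A i k‖ ^ 2 : ℝ) : ℂ) := by
  rw [Matrix.mul_apply]
  push_cast
  refine Finset.sum_congr rfl fun i _ => ?_
  rw [Matrix.conjTranspose_apply, mul_comm, Complex.star_def, Complex.mul_conj']

variable [Fintype n]

lemma norm_det_le_one_of_trace_le [DecidableEq n] {H : Matrix n n ℂ} (hH : H.PosSemidef)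
    (htr : H.trace.re ≤ Fintype.card n) : ‖H.det‖ ≤ 1 := by
  set ev := hH.isHermitian.eigenvalues
  have htrace : H.trace.re = ∑ i, ev i := by
    rw [hH.isHermitian.trace_eq_sum_eigenvalues]
    simp [ev]
  have hdet : ‖H.det‖ = ∏ i, ev i := by
    rw [hH.isHermitian.det_eq_prod_eigenvalues, norm_prod]
    exact Finset.prod_congr rfl fun i _ =>
      RCLike.norm_of_nonneg (K := ℂ) (hH.eigenvalues_nonneg i)
  calc ‖H.det‖ = ∏ i, ev i := hdet
    _ ≤ ∏ i, Real.exp (ev i - 1) :=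
        Finset.prod_le_prod (fun i _ => hH.eigenvalues_nonneg i) fun i _ => by
          linarith [Real.add_one_le_exp (ev i - 1)]
    _ = Real.exp (H.trace.re - Fintype.card n) := by
        rw [← Real.exp_sum, Finset.sum_sub_distrib, htrace]
        simp
    _ ≤ 1 := Real.exp_le_one_iff.2 (sub_nonpos.2 htr)

lemma norm_det_conjTranspose_mul_self_le [DecidableEq n] (A : Matrix m n ℂ) :
    ‖(Aᴴ * A).det‖ ≤ ∏ k, ∑ i, ‖A i k‖ ^ 2 := by
  set d : n → ℝ := fun k => √(∑ i, ‖A i k‖ ^ 2)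
  have hd (k : n) : d k ^ 2 = ∑ i, ‖A i k‖ ^ 2 := Real.sq_sqrt (by positivity)
  set B : Matrix m n ℂ := Matrix.of fun i k => A i k / d k
  have hAB : A = B * Matrix.diagonal fun k => (d k : ℂ) := by
    ext i k
    rw [Matrix.mul_diagonal]
    change A i k = A i k / d k * d k
    by_cases hk : d k = 0
    · have hcol := (Finset.sum_eq_zero_iff_of_nonneg fun i _ => by positivity).1
        ((hd k).symm.trans (by simp [hk])) i (Finset.mem_univ i)
      simpa [hk] using hcol
    · rw [div_mul_cancel₀ _ (Complex.ofReal_ne_zero.2 hk)]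
  have hunit (k : n) : ∑ i, ‖B i k‖ ^ 2 ≤ 1 := by
    simp only [B, Matrix.of_apply, norm_div, div_pow, Complex.norm_real, Real.norm_eq_abs, sq_abs,
      ← Finset.sum_div, hd]
    exact div_self_le_one _
  have htr : (Bᴴ * B).trace.re ≤ Fintype.card n := by
    simp only [Matrix.trace, Matrix.diag_apply, conjTranspose_mul_self_apply_self]
    rw [← Complex.ofReal_sum, Complex.ofReal_re]
    exact (Finset.sum_le_sum fun k _ => hunit k).trans_eq (by simp)
  have hB := norm_det_le_one_of_trace_le (Matrix.posSemidef_conjTranspose_mul_self B) htr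
  have hstar : star (fun k => (d k : ℂ)) = fun k => (d k : ℂ) := by ext k; simp
  have hnorm : ‖∏ k, (d k : ℂ)‖ = ∏ k, d k := by
    rw [← Complex.ofReal_prod, Complex.norm_of_nonneg (Finset.prod_nonneg fun k _ => by positivity)]
  calc ‖(Aᴴ * A).det‖ = (∏ k, d k ^ 2) * ‖(Bᴴ * B).det‖ := by
        rw [hAB, Matrix.conjTranspose_mul, Matrix.diagonal_conjTranspose, hstar, Matrix.mul_assoc,
          ← Matrix.mul_assoc Bᴴ, Matrix.det_mul, Matrix.det_mul, Matrix.det_diagonal, norm_mul,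
          norm_mul, hnorm, Finset.prod_pow]
        ring
    _ ≤ ∏ k, d k ^ 2 := mul_le_of_le_one_right (by positivity) hB
    _ = ∏ k, ∑ i, ‖A i k‖ ^ 2 := Finset.prod_congr rfl fun k _ => hd k

lemma sum_star_det_mul_det_submatrix [DecidableEq n] (A : Matrix m n ℂ) :
    ∑ φ : n → m, star (A.submatrix φ id).det * (A.submatrix φ id).det =
      (Fintype.card n).factorial * (Aᴴ * A).det := by
  classical
  have hterm (τ : Equiv.Perm n) :
      ∑ φ : n → m, (∏ i, star (A (φ i) (τ i))) * (A.submatrix φ id).det =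
        (Equiv.Perm.sign τ : ℂ) * (Aᴴ * A).det := by
    have hrows : (Aᴴ * A).submatrix τ id =
        Matrix.of fun i => ∑ x, fun k => star (A x (τ i)) * A x k := by
      ext i k
      simp [Matrix.mul_apply, Finset.sum_apply]
    rw [← Matrix.det_permute, hrows]
    simp_rw [← Matrix.det_mul_column]
    exact (Matrix.detRowAlternating.toMultilinearMap.map_sum
      fun i x k => star (A x (τ i)) * A x k).symm
  calc _ = ∑ τ : Equiv.Perm n, (Equiv.Perm.sign τ : ℂ) *
          ∑ φ : n → m, (∏ i, star (A (φ i) (τ i))) * (A.submatrix φ id).det := by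
        simp_rw [Finset.mul_sum]
        rw [Finset.sum_comm]
        refine Finset.sum_congr rfl fun φ _ => ?_
        simp_rw [← mul_assoc, ← Finset.sum_mul]
        rw [← Matrix.det_transpose (A.submatrix φ id), Matrix.det_apply']
        simp
    _ = _ := by
        simp_rw [hterm, ← mul_assoc, ← Int.cast_mul]
        simp [Fintype.card_perm]

lemma sum_norm_det_submatrix_sq_le [DecidableEq n] (A : Matrix m n ℂ) :
    ∑ φ : n → m, ‖(A.submatrix φ id).det‖ ^ 2 ≤
      (Fintype.card n).factorial * ∏ k, ∑ i, ‖A i k‖ ^ 2 := by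
  have hgram : ((∑ φ : n → m, ‖(A.submatrix φ id).det‖ ^ 2 : ℝ) : ℂ) =
      (Fintype.card n).factorial * (Aᴴ * A).det := by
    rw [← sum_star_det_mul_det_submatrix]
    push_cast
    exact Finset.sum_congr rfl fun φ _ => by
      rw [mul_comm, Complex.star_def, Complex.mul_conj']
  calc _ = ‖((∑ φ : n → m, ‖(A.submatrix φ id).det‖ ^ 2 : ℝ) : ℂ)‖ := by
        rw [Complex.norm_of_nonneg (by positivity)]
    _ = (Fintype.card n).factorial * ‖(Aᴴ * A).det‖ := by rw [hgram]; simp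
    _ ≤ _ := by gcongr; exact norm_det_conjTranspose_mul_self_le A

lemma det_eq_det_submatrix_of_row_eq_one [DecidableEq n] (M : Matrix n n ℂ) (J : Finset n)
    (hM : ∀ j ∉ J, M j = (1 : Matrix n n ℂ) j) :
    M.det = (M.submatrix (Subtype.val : J → n) Subtype.val).det := by
  have hone : (M.toSquareBlockProp fun j => j ∉ J) = 1 := by
    ext i k
    simp [Matrix.toSquareBlockProp, hM i i.2, Matrix.one_apply, Subtype.ext_iff]
  rw [Matrix.twoBlockTriangular_det M (· ∈ J), hone, Matrix.det_one, mul_one]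
  · congr!
  · intro i hi j hj
    rw [hM i hi, Matrix.one_apply_ne (ne_of_mem_of_not_mem hj hi).symm]

/-- The factorials are Gamma integrals, and the sum over `J` of the products is the expansion of
`∏ (1 + x t k) ≤ exp (x ∑ t k)`. -/
lemma sum_factorial_card_mul_prod_le {t : n → ℝ} (ht : ∀ k, 0 ≤ t k) (hT : ∑ k, t k < 1) :
    ∑ J : Finset n, (J.card.factorial : ℝ) * ∏ k ∈ J, t k ≤ (1 - ∑ k, t k)⁻¹ := by
  have hint (j : ℕ) : IntegrableOn (fun x : ℝ => Real.exp (-x) * x ^ j) (Set.Ioi 0) := by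
    have hGamma := Real.GammaIntegral_convergent (s := j + 1) (by positivity)
    simpa using hGamma
  have hfactorial (j : ℕ) : (j.factorial : ℝ) = ∫ x in Set.Ioi (0 : ℝ), Real.exp (-x) * x ^ j := by
    rw [← Real.Gamma_nat_eq_factorial, Real.Gamma_eq_integral (by positivity)]
    simp
  have hexpand (x : ℝ) : ∑ J : Finset n, Real.exp (-x) * x ^ J.card * ∏ k ∈ J, t k =
      Real.exp (-x) * ∏ k, (1 + x * t k) := by
    rw [Finset.prod_one_add, Finset.powerset_univ, Finset.mul_sum]
    refine Finset.sum_congr rfl fun J _ => ?_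
    rw [Finset.prod_mul_distrib, Finset.prod_const, mul_assoc]
  have hneg : ∑ k, t k - 1 < 0 := by linarith
  calc _ = ∫ x in Set.Ioi (0 : ℝ), Real.exp (-x) * ∏ k, (1 + x * t k) := by
        simp_rw [← hexpand]
        rw [integral_finsetSum _ fun J _ => (hint _).mul_const _]
        exact Finset.sum_congr rfl fun J _ => by rw [integral_mul_const, hfactorial]
    _ ≤ ∫ x in Set.Ioi (0 : ℝ), Real.exp ((∑ k, t k - 1) * x) := by
        refine setIntegral_mono_on ?_ (integrableOn_exp_mul_Ioi hneg 0) measurableSet_Ioi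
          fun x hx => ?_
        · simp_rw [← hexpand]
          exact integrable_finsetSum _ fun J _ => (hint _).mul_const _
        · calc Real.exp (-x) * ∏ k, (1 + x * t k)
              ≤ Real.exp (-x) * ∏ k, Real.exp (x * t k) := by
                gcongr with k
                · exact fun k _ => by have := mul_nonneg (le_of_lt hx) (ht k); linarith
                · linarith [Real.add_one_le_exp (x * t k)]
            _ = Real.exp ((∑ k, t k - 1) * x) := by
                rw [← Real.exp_sum, ← Real.exp_add, ← Finset.mul_sum]
                ring_nf
    _ = (1 - ∑ k, t k)⁻¹ := by
        rw [integral_exp_mul_Ioi hneg, mul_zero, Real.exp_zero, neg_div, ← div_neg, neg_sub,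
          one_div]

/-- The extension by `none` of a function on a finite set `J`. -/
def extendByNone [DecidableEq n] {α : Type*} {J : Finset n} (φ : J → α) (j : n) : Option α :=
  if h : j ∈ J then some (φ ⟨j, h⟩) else none

lemma sum_option_le_sum_extendByNone [DecidableEq n] {α : Type*} [Fintype α]
    {F : (n → Option α) → ℝ} (hF : ∀ ψ, 0 ≤ F ψ) :
    ∑ ψ, F ψ ≤ ∑ J : Finset n, ∑ φ : J → α, F (extendByNone φ) := by
  classical
  let e (p : Σ J : Finset n, J → α) : n → Option α := extendByNone p.2
  have he : Finset.univ.image e = Finset.univ := by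
    refine Finset.image_univ_of_surjective fun ψ => ?_
    refine ⟨⟨Finset.univ.filter fun j => (ψ j).isSome,
      fun j => (ψ j).get (Finset.mem_filter.1 j.2).2⟩, ?_⟩
    ext1 j
    cases hj : ψ j <;> simp [e, extendByNone, hj]
  rw [← he]
  refine (Finset.sum_image_le_of_nonneg fun ψ _ => hF ψ).trans_eq ?_
  rw [Fintype.sum_sigma]

/-- The matrix whose `j`-th row is that of the identity if `ψ j = none`, and the `i`-th row of `X`
if `ψ j = some i`; these matrices index the multilinear expansion of `det (1 + G X)` in the entries
of `G`. -/
def optionRows [DecidableEq n] (X : Matrix n n ℂ) (ψ : n → Option n) : Matrix n n ℂ :=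
  Matrix.of fun j => (ψ j).elim ((1 : Matrix n n ℂ) j) fun i => X i

lemma det_optionRows_extendByNone [DecidableEq n] (X : Matrix n n ℂ) {J : Finset n} (φ : J → n) :
    (optionRows X (extendByNone φ)).det =
      ((X.submatrix id (Subtype.val : J → n)).submatrix φ id).det := by
  rw [det_eq_det_submatrix_of_row_eq_one _ J]
  · congr 1
    ext i k
    simp [optionRows, extendByNone]
  · intro j hj
    ext k
    simp [optionRows, extendByNone, hj]

lemma sum_norm_det_optionRows_sub_sq_le [DecidableEq n] (X : Matrix n n ℂ)
    (hT : ∑ k, ∑ i, ‖X i k‖ ^ 2 < 1) :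
    ∑ ψ : n → Option n, ‖(optionRows X ψ).det - if ψ = (fun _ => none) then 1 else 0‖ ^ 2 ≤
      (∑ k, ∑ i, ‖X i k‖ ^ 2) / (1 - ∑ k, ∑ i, ‖X i k‖ ^ 2) := by
  set t : n → ℝ := fun k => ∑ i, ‖X i k‖ ^ 2
  have hJ (J : Finset n) : (∑ φ : J → n, ‖(optionRows X (extendByNone φ)).det -
      if extendByNone φ = (fun _ => none) then 1 else 0‖ ^ 2) ≤
        J.card.factorial * (∏ k ∈ J, t k) - if J = ∅ then 1 else 0 := by
    rcases J.eq_empty_or_nonempty with rfl | ⟨j₀, hj₀⟩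
    · have hnone (φ : (∅ : Finset n) → n) : extendByNone φ = fun _ => none := by
        ext1 j
        simp [extendByNone]
      have hone : (optionRows X fun _ => none).det = 1 := Matrix.det_one
      simp [hnone, hone]
    have hne (φ : J → n) : extendByNone φ ≠ fun _ => none := fun h => by
      simpa [extendByNone, hj₀] using congrFun h j₀
    simp only [hne, det_optionRows_extendByNone, if_false, sub_zero,
      if_neg (Finset.ne_empty_of_mem hj₀)]
    refine (sum_norm_det_submatrix_sq_le _).trans_eq ?_
    simp only [Fintype.card_coe, Matrix.submatrix_apply, id]
    rw [Finset.prod_coe_sort J t]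
  have hT' : 0 < 1 - ∑ k, t k := sub_pos.2 hT
  calc _ ≤ ∑ J : Finset n, (J.card.factorial * (∏ k ∈ J, t k) - if J = ∅ then 1 else 0) :=
        (sum_option_le_sum_extendByNone fun ψ => by positivity).trans
          (Finset.sum_le_sum fun J _ => hJ J)
    _ ≤ (1 - ∑ k, t k)⁻¹ - 1 := by
        rw [Finset.sum_sub_distrib, Finset.sum_ite_eq' Finset.univ (∅ : Finset n),
          if_pos (Finset.mem_univ _)]
        exact sub_le_sub_right (sum_factorial_card_mul_prod_le (fun k => by positivity) hT) 1
    _ = (∑ k, t k) / (1 - ∑ k, t k) := by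
        rw [eq_div_iff hT'.ne', sub_mul, inv_mul_cancel₀ hT'.ne']
        ring

lemma lintegral_enorm_det_mul_sub_one_sq_le {m : ℕ} {D X : Matrix (Fin m) (Fin m) ℂ}
    (hDX : D * X = 1) (hT : ∑ k, ∑ i, ‖X i k‖ ^ 2 < 1) :
    ∫⁻ g, ‖(Matrix.of (realShift D g) * X).det - 1‖ₑ ^ 2
        ∂(Measure.pi fun _ : Fin m => stdGaussianPi (Fin m)) ≤
      ENNReal.ofReal ((∑ k, ∑ i, ‖X i k‖ ^ 2) / (1 - ∑ k, ∑ i, ‖X i k‖ ^ 2)) := by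
  set f : MultilinearMap ℂ (fun _ : Fin m => Fin m → ℂ) ℂ :=
    (Matrix.detRowAlternating (R := ℂ) (n := Fin m)).toMultilinearMap.compLinearMap
      fun _ => X.vecMulLinear
  have hf (v : Fin m → Fin m → ℂ) : f v = (Matrix.of v * X).det := rfl
  have hrows (ψ : Fin m → Option (Fin m)) :
      Matrix.of (fun j => (ψ j).elim (D j) fun i => Pi.single i 1) * X = optionRows X ψ := by
    ext j k
    rw [optionRows, ← hDX]
    cases hj : ψ j <;> simp [Matrix.mul_apply, hj, Pi.single_apply]
  have hsecond := lintegral_multilinearMap_sub_sq_le f D 1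
  simp only [hf, hrows] at hsecond
  refine hsecond.trans (le_trans (le_of_eq ?_)
    (ENNReal.ofReal_le_ofReal (sum_norm_det_optionRows_sub_sq_le X hT)))
  rw [ENNReal.ofReal_sum_of_nonneg fun ψ _ => by positivity]
  exact Finset.sum_congr rfl fun ψ _ => by
    rw [ENNReal.ofReal_pow (norm_nonneg _), ofReal_norm]

end DeterminantExpansion

section GaussianMinors

variable {m s : ℕ}

lemma sum_det_last_rows_single_ge (u : Fin m → (Fin m ⊕ Fin s) → ℂ) :
    (s.factorial : ℝ≥0∞) * ‖((Matrix.of u).submatrix id Sum.inl).det‖ₑ ^ 2 ≤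
      ∑ φ : Fin s → Fin m ⊕ Fin s,
        ‖(Matrix.of (Sum.elim u fun j => Pi.single (φ j) 1)).det‖ₑ ^ 2 := by
  have hperm (π : Equiv.Perm (Fin s)) :
      ‖(Matrix.of (Sum.elim u fun j => Pi.single (Sum.inr (π j)) 1)).det‖ₑ =
        ‖((Matrix.of u).submatrix id Sum.inl).det‖ₑ := by
    have hblocks : Matrix.of (Sum.elim u fun j => Pi.single (Sum.inr (π j)) (1 : ℂ)) =
        Matrix.fromBlocks ((Matrix.of u).submatrix id Sum.inl)
          ((Matrix.of u).submatrix id Sum.inr) 0 (π.permMatrix ℂ) := by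
      ext i j
      rcases i with i | i <;> rcases j with j | j <;>
        simp [Matrix.fromBlocks, Pi.single_apply, Equiv.Perm.permMatrix]
    rw [hblocks, Matrix.det_fromBlocks_zero₂₁, Matrix.det_permutation, enorm_mul]
    rcases Int.units_eq_one_or (Equiv.Perm.sign π) with h | h <;> simp [h]
  have hinj : Function.Injective fun (π : Equiv.Perm (Fin s)) (j : Fin s) =>
      (Sum.inr (π j) : Fin m ⊕ Fin s) :=
    fun π π' h => Equiv.ext fun j => Sum.inr_injective (congrFun h j)
  calc _ = ∑ π : Equiv.Perm (Fin s),
          ‖(Matrix.of (Sum.elim u fun j => Pi.single (Sum.inr (π j)) 1)).det‖ₑ ^ 2 := by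
        simp only [hperm, Finset.sum_const, Finset.card_univ, Fintype.card_perm, Fintype.card_fin,
          nsmul_eq_mul]
    _ = ∑ φ ∈ Finset.univ.map ⟨_, hinj⟩,
          ‖(Matrix.of (Sum.elim u fun j => Pi.single (φ j) 1)).det‖ₑ ^ 2 := by
        rw [Finset.sum_map]
        rfl
    _ ≤ _ := Finset.sum_le_sum_of_subset (Finset.subset_univ _)

lemma measure_norm_det_last_rows_le (u : Fin m → (Fin m ⊕ Fin s) → ℂ)
    (b : Fin s → (Fin m ⊕ Fin s) → ℂ) {c θ : ℝ} (hc : 0 < c) (hθ : 0 < θ)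
    (hu : c ≤ ‖((Matrix.of u).submatrix id Sum.inl).det‖) :
    (Measure.pi fun _ : Fin s => stdGaussianPi (Fin m ⊕ Fin s))
        {g | ‖(Matrix.of (Sum.elim u (realShift b g))).det‖ ≤ c * √s.factorial * θ} ≤
      3 ^ s * ENNReal.ofReal (√θ) := by
  have hcs : 0 < c * √s.factorial := mul_pos hc (by positivity)
  have hsq : ENNReal.ofReal (c * √s.factorial) ^ 2 ≤
      s.factorial * ‖((Matrix.of u).submatrix id Sum.inl).det‖ₑ ^ 2 := by
    rw [← ENNReal.ofReal_pow hcs.le, mul_pow, Real.sq_sqrt (Nat.cast_nonneg _), mul_comm,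
      ENNReal.ofReal_mul (Nat.cast_nonneg _), ENNReal.ofReal_natCast, ENNReal.ofReal_pow hc.le,
      ← ofReal_norm]
    gcongr
  have hball := measure_multilinearMap_realShift_le
    ((Matrix.detRowAlternating (R := ℂ) (n := Fin m ⊕ Fin s)).toMultilinearMap.currySum u) b
    (c := ENNReal.ofReal (c * √s.factorial)) (θ := ENNReal.ofReal θ) (by simpa using hcs)
    ENNReal.ofReal_ne_top (by simpa using hθ) ENNReal.ofReal_ne_top
    (hsq.trans (sum_det_last_rows_single_ge u))
  rw [ENNReal.ofReal_rpow_of_pos hθ, ← Real.sqrt_eq_rpow] at hball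
  refine (measure_mono fun g hg => ?_).trans hball
  rw [Set.mem_ofPred_eq, ← ENNReal.ofReal_mul hcs.le, ← ofReal_norm]
  exact ENNReal.ofReal_le_ofReal hg

lemma measure_norm_det_realShift_lt_le {D X : Matrix (Fin m) (Fin m) ℂ} (hDX : D * X = 1)
    (hT : ∑ k, ∑ i, ‖X i k‖ ^ 2 < 1) :
    (Measure.pi fun _ : Fin m => stdGaussianPi (Fin m))
        {g | ‖(Matrix.of (realShift D g)).det‖ < 2⁻¹ * ‖D.det‖} ≤
      4 * ENNReal.ofReal ((∑ k, ∑ i, ‖X i k‖ ^ 2) / (1 - ∑ k, ∑ i, ‖X i k‖ ^ 2)) := by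
  have hdet : ‖D.det‖ * ‖X.det‖ = 1 := by
    rw [← norm_mul, ← Matrix.det_mul, hDX, Matrix.det_one, norm_one]
  have hX : 0 < ‖X.det‖ := (norm_nonneg _).lt_of_ne' (right_ne_zero_of_mul_eq_one hdet)
  have hdeviation {g : Fin m → Fin m → ℝ}
      (hg : ‖(Matrix.of (realShift D g)).det‖ < 2⁻¹ * ‖D.det‖) :
      4⁻¹ ≤ ‖(Matrix.of (realShift D g) * X).det - 1‖ₑ ^ 2 := by
    have hlt : ‖(Matrix.of (realShift D g) * X).det‖ < 2⁻¹ := by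
      rw [Matrix.det_mul, norm_mul]
      simpa only [mul_assoc, hdet, mul_one] using mul_lt_mul_of_pos_right hg hX
    have hge : 2⁻¹ ≤ ‖(Matrix.of (realShift D g) * X).det - 1‖ := by
      have := norm_sub_norm_le 1 (Matrix.of (realShift D g) * X).det
      rw [norm_one, norm_sub_rev] at this
      linarith
    rw [← ofReal_norm, ← ENNReal.ofReal_pow (norm_nonneg _),
      show (4⁻¹ : ℝ≥0∞) = ENNReal.ofReal (2⁻¹ ^ 2) by
        rw [inv_pow, ENNReal.ofReal_inv_of_pos (by norm_num)]; norm_num]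
    gcongr
  have hmeas : Measurable fun g : Fin m → Fin m → ℝ =>
      ‖(Matrix.of (realShift D g) * X).det - 1‖ₑ ^ 2 := by
    have : Continuous fun g : Fin m → Fin m → ℝ => (Matrix.of (realShift D g) * X).det := by
      unfold realShift
      fun_prop
    exact (this.measurable.sub_const 1).enorm.pow_const 2
  refine (measure_mono fun g hg => hdeviation hg).trans ((meas_ge_le_lintegral_div
    hmeas.aemeasurable (by simp) (by simp)).trans ?_)
  rw [ENNReal.div_eq_inv_mul, inv_inv]
  exact mul_le_mul_right (lintegral_enorm_det_mul_sub_one_sq_le hDX hT) 4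

lemma measure_prod_le_measure_add {α β : Type*} [MeasurableSpace α] [MeasurableSpace β]
    {μ : Measure α} [IsProbabilityMeasure μ] {ν : Measure β} [IsProbabilityMeasure ν]
    {E : Set (α × β)} (hE : MeasurableSet E) {B : Set α} {c : ℝ≥0∞}
    (h : ∀ x ∉ B, ν (Prod.mk x ⁻¹' E) ≤ c) : μ.prod ν E ≤ μ B + c := by
  have hfiber (x : α) : ν (Prod.mk x ⁻¹' E) ≤ B.indicator 1 x + c := by
    by_cases hx : x ∈ B
    · rw [Set.indicator_of_mem hx]
      exact prob_le_one.trans le_self_add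
    · exact (h x hx).trans le_add_self
  rw [Measure.prod_apply hE]
  refine (lintegral_mono hfiber).trans ?_
  rw [lintegral_add_right _ measurable_const, lintegral_const, measure_univ, mul_one]
  gcongr
  exact lintegral_indicator_one_le B

lemma measurePreserving_rows_comp_inl (m s : ℕ) :
    MeasurePreserving (fun (h : Fin m → (Fin m ⊕ Fin s) → ℝ) j k => h j (Sum.inl k))
      (Measure.pi fun _ => stdGaussianPi (Fin m ⊕ Fin s))
      (Measure.pi fun _ => stdGaussianPi (Fin m)) :=
  measurePreserving_pi (f := fun (_ : Fin m) (x : (Fin m ⊕ Fin s) → ℝ) k => x (Sum.inl k)) _ _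
    fun _ => measurePreserving_fst.comp
      (measurePreserving_sumPiEquivProdPi fun _ : Fin m ⊕ Fin s => gaussianReal 0 1)

lemma measure_prod_norm_det_realShift_le (u : Fin m → (Fin m ⊕ Fin s) → ℂ)
    (b : Fin s → (Fin m ⊕ Fin s) → ℂ) {X : Matrix (Fin m) (Fin m) ℂ}
    (hX : (Matrix.of u).submatrix id Sum.inl * X = 1) (hT : ∑ k, ∑ i, ‖X i k‖ ^ 2 < 1)
    {θ : ℝ} (hθ : 0 < θ) :
    ((Measure.pi fun _ : Fin m => stdGaussianPi (Fin m ⊕ Fin s)).prod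
      (Measure.pi fun _ : Fin s => stdGaussianPi (Fin m ⊕ Fin s)))
        {p | ‖(Matrix.of (Sum.elim (realShift u p.1) (realShift b p.2))).det‖ ≤
          2⁻¹ * ‖((Matrix.of u).submatrix id Sum.inl).det‖ * √s.factorial * θ} ≤
      4 * ENNReal.ofReal ((∑ k, ∑ i, ‖X i k‖ ^ 2) / (1 - ∑ k, ∑ i, ‖X i k‖ ^ 2)) +
        3 ^ s * ENNReal.ofReal (√θ) := by
  set D := (Matrix.of u).submatrix id Sum.inl
  have hD0 : 0 < ‖D.det‖ := norm_pos_iff.2 <| left_ne_zero_of_mul_eq_one <| by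
    rw [← Matrix.det_mul, hX, Matrix.det_one]
  have hcont : Continuous fun p : (Fin m → (Fin m ⊕ Fin s) → ℝ) × (Fin s → (Fin m ⊕ Fin s) → ℝ) =>
      (Matrix.of (Sum.elim (realShift u p.1) (realShift b p.2))).det := by
    refine Continuous.matrix_det (continuous_matrix fun i j => ?_)
    rcases i with i | i <;> simp only [Matrix.of_apply, Sum.elim_inl, Sum.elim_inr, realShift] <;>
      fun_prop
  set minor : (Fin m → (Fin m ⊕ Fin s) → ℝ) → Fin m → Fin m → ℝ := fun h j k => h j (Sum.inl k)
  set B := minor ⁻¹' {g | ‖(Matrix.of (realShift D g)).det‖ < 2⁻¹ * ‖D.det‖}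
  have hB : (Measure.pi fun _ => stdGaussianPi (Fin m ⊕ Fin s)) B ≤
      4 * ENNReal.ofReal ((∑ k, ∑ i, ‖X i k‖ ^ 2) / (1 - ∑ k, ∑ i, ‖X i k‖ ^ 2)) :=
    ((measurePreserving_rows_comp_inl m s).measure_preimage_le _).trans
      (measure_norm_det_realShift_lt_le hX hT)
  refine (measure_prod_le_measure_add (measurableSet_le hcont.norm.measurable measurable_const)
    fun h hh => ?_).trans (add_le_add_left hB _)
  exact measure_norm_det_last_rows_le (realShift u h) b (mul_pos (by norm_num) hD0) hθ
    (not_lt.1 hh)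

lemma IsStandardGaussianMatrix.hasLaw_rows {Ω : Type*} [MeasurableSpace Ω] {P : Measure Ω}
    [IsProbabilityMeasure P] {N : ℕ} {G : Ω → Matrix (Fin N) (Fin N) ℝ}
    (hG : IsStandardGaussianMatrix P G) (e₁ e₂ : Fin m ⊕ Fin s ≃ Fin N) :
    HasLaw (fun ω => (fun j k => G ω (e₁ (Sum.inl j)) (e₂ k),
        fun j k => G ω (e₁ (Sum.inr j)) (e₂ k)))
      ((Measure.pi fun _ : Fin m => stdGaussianPi (Fin m ⊕ Fin s)).prod
        (Measure.pi fun _ : Fin s => stdGaussianPi (Fin m ⊕ Fin s))) P := by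
  have hentries : HasLaw (fun ω (p : (Fin m ⊕ Fin s) × (Fin m ⊕ Fin s)) => G ω (e₁ p.1) (e₂ p.2))
      (Measure.pi fun _ => gaussianReal 0 1) P :=
    (hG.1.precomp (e₁.prodCongr e₂).injective).hasLaw_pi fun p => hG.2 (e₁ p.1) (e₂ p.2)
  have hcurry := Measure.infinitePi_map_curry
    fun _ _ : Fin m ⊕ Fin s => gaussianReal 0 1
  simp only [Measure.infinitePi_eq_pi] at hcurry
  have hrows : HasLaw (MeasurableEquiv.curry (Fin m ⊕ Fin s) (Fin m ⊕ Fin s) ℝ)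
      (Measure.pi fun _ : Fin m ⊕ Fin s => stdGaussianPi (Fin m ⊕ Fin s))
      (Measure.pi fun _ => gaussianReal 0 1) :=
    ⟨(MeasurableEquiv.measurable _).aemeasurable, hcurry⟩
  exact (measurePreserving_sumPiEquivProdPi
    fun _ : Fin m ⊕ Fin s => stdGaussianPi (Fin m ⊕ Fin s)).hasLaw.comp (hrows.comp hentries)

lemma exists_sumEquiv_extending {α β γ : Type*} [Fintype α] [Fintype β] [Fintype γ]
    (hcard : Fintype.card α + Fintype.card β = Fintype.card γ) {f : α → γ}
    (hf : Function.Injective f) : ∃ e : α ⊕ β ≃ γ, ∀ a, e (Sum.inl a) = f a := by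
  classical
  have hcompl : Fintype.card β = Fintype.card ((Set.range f)ᶜ : Set γ) := by
    rw [Fintype.card_compl_set, Set.card_range_of_injective hf]
    lia
  exact ⟨((Equiv.ofInjective f hf).sumCongr (Fintype.equivOfCardEq hcompl)).trans
    (Equiv.Set.sumCompl _), fun a => by simp⟩

lemma norm_det_submatrix_equiv {m n : Type*} [Fintype m] [DecidableEq m] [Fintype n]
    [DecidableEq n] (A : Matrix n n ℂ) (e₁ e₂ : m ≃ n) :
    ‖(A.submatrix e₁ e₂).det‖ = ‖A.det‖ := by
  have hfactor : A.submatrix e₁ e₂ = (A.submatrix (e₂.symm.trans e₁) id).submatrix e₂ e₂ := by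
    ext i j
    simp
  rw [hfactor, Matrix.det_submatrix_equiv_self, Matrix.det_permute, norm_mul]
  rcases Int.units_eq_one_or (Equiv.Perm.sign (e₂.symm.trans e₁)) with h | h <;> simp [h]

variable {Ω : Type*} [MeasurableSpace Ω] {P : Measure Ω} [IsProbabilityMeasure P] {N : ℕ}
  {G : Ω → Matrix (Fin N) (Fin N) ℝ} {κ : Type*} [Fintype κ] [DecidableEq κ]

lemma IsStandardGaussianMatrix.measure_norm_det_add_le (hG : IsStandardGaussianMatrix P G)
    (A : Matrix (Fin N) (Fin N) ℂ) (hs : Fintype.card κ + s = N) {ρ χ : κ → Fin N}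
    (hρ : Function.Injective ρ) (hχ : Function.Injective χ) {X : Matrix κ κ ℂ}
    (hX : A.submatrix ρ χ * X = 1) (hT : ∑ k, ∑ i, ‖X i k‖ ^ 2 < 1) {θ : ℝ} (hθ : 0 < θ) :
    P {ω | ‖(A + (G ω).map Complex.ofReal).det‖ ≤
        2⁻¹ * ‖(A.submatrix ρ χ).det‖ * √s.factorial * θ} ≤
      4 * ENNReal.ofReal ((∑ k, ∑ i, ‖X i k‖ ^ 2) / (1 - ∑ k, ∑ i, ‖X i k‖ ^ 2)) +
        3 ^ s * ENNReal.ofReal (√θ) := by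
  let e : Fin (Fintype.card κ) ≃ κ := (Fintype.equivFin κ).symm
  have hcard : Fintype.card (Fin (Fintype.card κ)) + Fintype.card (Fin s) =
      Fintype.card (Fin N) := by simpa using hs
  obtain ⟨e₁, he₁⟩ := exists_sumEquiv_extending hcard (hρ.comp e.injective)
  obtain ⟨e₂, he₂⟩ := exists_sumEquiv_extending hcard (hχ.comp e.injective)
  set u : Fin (Fintype.card κ) → (Fin (Fintype.card κ) ⊕ Fin s) → ℂ :=
    fun j k => A (e₁ (Sum.inl j)) (e₂ k)
  set b : Fin s → (Fin (Fintype.card κ) ⊕ Fin s) → ℂ := fun j k => A (e₁ (Sum.inr j)) (e₂ k)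
  have hu : (Matrix.of u).submatrix id Sum.inl = (A.submatrix ρ χ).submatrix e e := by
    ext i j
    simp [u, he₁, he₂]
  have huX : (Matrix.of u).submatrix id Sum.inl * X.submatrix e e = 1 := by
    rw [hu, Matrix.submatrix_mul_equiv, hX, Matrix.submatrix_one_equiv]
  have hsum : ∑ k, ∑ i, ‖X.submatrix e e i k‖ ^ 2 = ∑ k, ∑ i, ‖X i k‖ ^ 2 := by
    rw [← e.sum_comp fun k => ∑ i, ‖X i k‖ ^ 2]
    exact Finset.sum_congr rfl fun k _ => e.sum_comp fun i => ‖X i (e k)‖ ^ 2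
  have hball := measure_prod_norm_det_realShift_le u b huX (by rwa [hsum]) hθ
  rw [hu, Matrix.det_submatrix_equiv_self, hsum, ← (hG.hasLaw_rows e₁ e₂).map_eq] at hball
  refine (le_of_eq ?_).trans
    ((Measure.le_map_apply (hG.hasLaw_rows e₁ e₂).aemeasurable _).trans hball)
  congr 1
  ext ω
  have hrows : (A + (G ω).map Complex.ofReal).submatrix e₁ e₂ = Matrix.of (Sum.elim
      (realShift u fun j k => G ω (e₁ (Sum.inl j)) (e₂ k))
      (realShift b fun j k => G ω (e₁ (Sum.inr j)) (e₂ k))) := by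
    ext i j
    rcases i with i | i <;> simp [realShift, u, b]
  rw [Set.mem_preimage, Set.mem_ofPred_eq, Set.mem_ofPred_eq, ← hrows, norm_det_submatrix_equiv]

lemma IsStandardGaussianMatrix.measure_norm_det_add_smul_le (hG : IsStandardGaussianMatrix P G)
    (A : Matrix (Fin N) (Fin N) ℂ) {σ : ℝ} (hσ : 0 < σ) (hs : Fintype.card κ + s = N)
    {ρ χ : κ → Fin N} (hρ : Function.Injective ρ) (hχ : Function.Injective χ) {X : Matrix κ κ ℂ}
    (hX : A.submatrix ρ χ * X = 1) {T : ℝ} (hXT : σ ^ 2 * ∑ k, ∑ i, ‖X i k‖ ^ 2 ≤ T) (hT : T < 1)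
    {θ : ℝ} (hθ : 0 < θ) :
    P {ω | ‖(A + (σ : ℂ) • (G ω).map Complex.ofReal).det‖ ≤
        2⁻¹ * (σ ^ s * ‖(A.submatrix ρ χ).det‖) * √s.factorial * θ} ≤
      4 * ENNReal.ofReal (T / (1 - T)) + 3 ^ s * ENNReal.ofReal (√θ) := by
  have hσ' : (σ : ℂ) ≠ 0 := by exact_mod_cast hσ.ne'
  have hsub : ((σ : ℂ)⁻¹ • A).submatrix ρ χ = (σ : ℂ)⁻¹ • A.submatrix ρ χ := rfl
  have hX' : ((σ : ℂ)⁻¹ • A).submatrix ρ χ * ((σ : ℂ) • X) = 1 := by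
    rw [hsub, Matrix.smul_mul, Matrix.mul_smul, smul_smul,
      inv_mul_cancel₀ hσ', one_smul, hX]
  have hsum : ∑ k, ∑ i, ‖((σ : ℂ) • X) i k‖ ^ 2 = σ ^ 2 * ∑ k, ∑ i, ‖X i k‖ ^ 2 := by
    simp [mul_pow, Finset.mul_sum]
  have hball := hG.measure_norm_det_add_le ((σ : ℂ)⁻¹ • A) hs hρ hχ hX'
    (hsum.trans_lt (hXT.trans_lt hT)) hθ
  have hdet (ω : Ω) : ‖(A + (σ : ℂ) • (G ω).map Complex.ofReal).det‖ =
      σ ^ N * ‖((σ : ℂ)⁻¹ • A + (G ω).map Complex.ofReal).det‖ := by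
    have : A + (σ : ℂ) • (G ω).map Complex.ofReal =
        (σ : ℂ) • ((σ : ℂ)⁻¹ • A + (G ω).map Complex.ofReal) := by
      rw [smul_add, smul_smul, mul_inv_cancel₀ hσ', one_smul]
    rw [this, Matrix.det_smul, Fintype.card_fin, norm_mul, norm_pow, Complex.norm_real,
      Real.norm_of_nonneg hσ.le]
  have hminor : σ ^ s * ‖(A.submatrix ρ χ).det‖ =
      σ ^ N * ‖(((σ : ℂ)⁻¹ • A).submatrix ρ χ).det‖ := by
    rw [hsub, Matrix.det_smul, norm_mul, norm_pow, norm_inv, inv_pow,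
      Complex.norm_real, Real.norm_of_nonneg hσ.le, show σ ^ N = σ ^ Fintype.card κ * σ ^ s by
        rw [← hs, pow_add]]
    field_simp
  refine (measure_mono fun ω hω => ?_).trans (hball.trans ?_)
  · rw [Set.mem_ofPred_eq, hdet, hminor] at hω
    refine le_of_mul_le_mul_left (hω.trans_eq ?_) (pow_pos hσ N)
    ring
  · have hT0 : 0 ≤ T := le_trans (by positivity) hXT
    have : 0 < 1 - T := sub_pos.2 hT
    rw [hsum]
    gcongr

end GaussianMinors

section JordanBlocks

variable {K : Type*}

/-- The `n × n` matrix with `a` on the diagonal and `b` on the superdiagonal; a Jordan block is the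
case `b = 1`. -/
def bidiagonal [Zero K] (n : ℕ) (a b : K) : Matrix (Fin n) (Fin n) K :=
  Matrix.of fun i j => if i = j then a else if (i : ℕ) + 1 = j then b else 0

lemma det_bidiagonal [CommRing K] (n : ℕ) (a b : K) : (bidiagonal n a b).det = a ^ n := by
  rw [Matrix.det_of_isUpperTriangular]
  · simp [bidiagonal]
  · intro i j (hij : j < i)
    simp only [bidiagonal, Matrix.of_apply]
    rw [if_neg hij.ne', if_neg (by omega)]

lemma sum_bidiagonal_mul [CommRing K] {n : ℕ} (a b : K) (i : Fin n) {f : ℕ → K} (hf : f n = 0) :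
    ∑ j : Fin n, bidiagonal n a b i j * f j = a * f i + b * f (i + 1) := by
  have hsplit (j : Fin n) : bidiagonal n a b i j * f j =
      (if i = j then a * f j else 0) + if (i : ℕ) + 1 = j then b * f j else 0 := by
    simp only [bidiagonal, Matrix.of_apply, Fin.ext_iff]
    split_ifs <;> first | omega | simp
  simp_rw [hsplit]
  rw [Finset.sum_add_distrib, Finset.sum_ite_eq, if_pos (Finset.mem_univ i),
    Fin.sum_univ_eq_sum_range (fun j => if (i : ℕ) + 1 = j then b * f j else 0),
    Finset.sum_ite_eq]
  split_ifs with hi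
  · rfl
  · rw [show (i : ℕ) + 1 = n by rw [Finset.mem_range] at hi; omega, hf, mul_zero]

/-- The inverse of `bidiagonal n a b`. -/
def bidiagonalInv [Field K] (n : ℕ) (a b : K) : Matrix (Fin n) (Fin n) K :=
  Matrix.of fun i k => if i ≤ k then a⁻¹ * (-b / a) ^ ((k : ℕ) - i) else 0

lemma bidiagonal_mul_bidiagonalInv [Field K] (n : ℕ) {a : K} (ha : a ≠ 0) (b : K) :
    bidiagonal n a b * bidiagonalInv n a b = 1 := by
  ext i k
  have hsum := sum_bidiagonal_mul a b i
    (f := fun j => if j ≤ k then a⁻¹ * (-b / a) ^ ((k : ℕ) - j) else 0) (if_neg (by omega))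
  rw [Matrix.mul_apply]
  refine hsum.trans ?_
  rcases lt_trichotomy i k with h | rfl | h
  · rw [if_pos (by omega), if_pos (by omega), Matrix.one_apply_ne h.ne,
      show (k : ℕ) - i = k - (i + 1) + 1 by omega, pow_succ]
    field_simp
    ring
  · simp [ha]
  · rw [if_neg (by omega), if_neg (by omega), Matrix.one_apply_ne h.ne']
    simp

lemma sum_norm_sq_bidiagonalInv_le [NormedField K] (n : ℕ) (a b : K) :
    ∑ k, ∑ i, ‖bidiagonalInv n a b i k‖ ^ 2 ≤
      n * ((‖a‖ ^ 2)⁻¹ * ∑ l ∈ Finset.range n, (‖b‖ ^ 2 / ‖a‖ ^ 2) ^ l) := by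
  have hcol (k : Fin n) : ∑ i, ‖bidiagonalInv n a b i k‖ ^ 2 ≤
      (‖a‖ ^ 2)⁻¹ * ∑ l ∈ Finset.range n, (‖b‖ ^ 2 / ‖a‖ ^ 2) ^ l := by
    have hentry (i : Fin n) : ‖bidiagonalInv n a b i k‖ ^ 2 =
        if (i : ℕ) ∈ Finset.range (k + 1) then
          (‖a‖ ^ 2)⁻¹ * (‖b‖ ^ 2 / ‖a‖ ^ 2) ^ ((k : ℕ) - i) else 0 := by
      simp only [bidiagonalInv, Matrix.of_apply, Finset.mem_range, Nat.lt_succ_iff, Fin.le_def]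
      split_ifs
      · rw [norm_mul, mul_pow, norm_inv, inv_pow, norm_pow, norm_div, norm_neg, pow_right_comm,
          div_pow]
      · simp
    have hk : Finset.range (k + 1) ⊆ Finset.range n := Finset.range_mono k.2
    simp_rw [hentry]
    rw [Fin.sum_univ_eq_sum_range (fun i => if i ∈ Finset.range (k + 1) then
        (‖a‖ ^ 2)⁻¹ * (‖b‖ ^ 2 / ‖a‖ ^ 2) ^ ((k : ℕ) - i) else 0), Finset.sum_ite_mem,
      Finset.inter_eq_right.2 hk, ← Finset.mul_sum]
    refine mul_le_mul_of_nonneg_left ?_ (by positivity)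
    rw [← Finset.sum_range_reflect]
    refine (Finset.sum_le_sum_of_subset_of_nonneg hk fun _ _ _ => by positivity).trans' ?_
    refine (Finset.sum_congr rfl fun i hi => ?_).le
    have := Finset.mem_range.1 hi
    congr 1
    omega
  refine (Finset.sum_le_card_nsmul _ _ _ fun k _ => hcol k).trans_eq ?_
  simp

/-- The Jordan block of size `n` and eigenvalue `w` without its first `d` columns and its last `d`
rows. -/
def truncatedBlock (n d : ℕ) (w : ℂ) : Matrix (Fin (n - d)) (Fin (n - d)) ℂ :=
  Matrix.of fun i j => if (i : ℕ) = j + d then w else if (i : ℕ) + 1 = j + d then 1 else 0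

lemma truncatedBlock_zero (n : ℕ) (w : ℂ) : truncatedBlock n 0 w = bidiagonal n w 1 := by
  ext i j
  simp [truncatedBlock, bidiagonal, Fin.ext_iff]

lemma truncatedBlock_one (n : ℕ) (w : ℂ) :
    truncatedBlock n 1 w = (bidiagonal (n - 1) 1 w).transpose := by
  ext i j
  simp only [truncatedBlock, bidiagonal, Matrix.transpose_apply, Matrix.of_apply, Fin.ext_iff]
  split_ifs <;> first | omega | rfl

lemma det_truncatedBlock_zero (n : ℕ) (w : ℂ) : (truncatedBlock n 0 w).det = w ^ n := by
  rw [truncatedBlock_zero]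
  exact det_bidiagonal n w 1

lemma det_truncatedBlock_one (n : ℕ) (w : ℂ) : (truncatedBlock n 1 w).det = 1 := by
  rw [truncatedBlock_one, Matrix.det_transpose, det_bidiagonal, one_pow]

lemma exists_truncatedBlock_zero_mul_eq_one (n : ℕ) {w : ℂ} (hw : w ≠ 0) :
    ∃ X, truncatedBlock n 0 w * X = 1 ∧ ∑ k, ∑ i, ‖X i k‖ ^ 2 ≤
      n * ((‖w‖ ^ 2)⁻¹ * ∑ l ∈ Finset.range n, ((‖w‖ ^ 2)⁻¹) ^ l) := by
  rw [truncatedBlock_zero]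
  exact ⟨_, bidiagonal_mul_bidiagonalInv n hw 1,
    (sum_norm_sq_bidiagonalInv_le n w 1).trans_eq (by simp)⟩

lemma exists_truncatedBlock_one_mul_eq_one (n : ℕ) (w : ℂ) :
    ∃ X, truncatedBlock n 1 w * X = 1 ∧
      ∑ k, ∑ i, ‖X i k‖ ^ 2 ≤ n * ∑ l ∈ Finset.range n, (‖w‖ ^ 2) ^ l := by
  rw [truncatedBlock_one]
  refine ⟨(bidiagonalInv (n - 1) 1 w).transpose, ?_, ?_⟩
  · rw [← Matrix.transpose_mul, mul_eq_one_comm.1 (bidiagonal_mul_bidiagonalInv _ one_ne_zero w),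
      Matrix.transpose_one]
  · simp only [Matrix.transpose_apply]
    rw [Finset.sum_comm]
    refine (sum_norm_sq_bidiagonalInv_le (n - 1) 1 w).trans ?_
    rw [norm_one, one_pow, inv_one, one_mul, div_one]
    gcongr <;> exact Nat.sub_le n 1

lemma le_of_min_natCast_inv_lt {n : ℕ} {x S Q : ℝ} (hSn : S ≤ n) (hSx : S * x ≤ 1) (hx : 0 ≤ x)
    (h : min (n : ℝ≥0∞) (ENNReal.ofReal x)⁻¹ < ENNReal.ofReal Q) : S ≤ Q := by
  have hmin : ENNReal.ofReal S ≤ min (n : ℝ≥0∞) (ENNReal.ofReal x)⁻¹ := by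
    refine le_min (ENNReal.ofReal_le_of_le_toReal hSn) (ENNReal.le_inv_iff_mul_le.2 ?_)
    rw [← ENNReal.ofReal_mul' hx]
    exact ENNReal.ofReal_le_one.2 hSx
  exact (ENNReal.ofReal_lt_ofReal_iff'.1 (hmin.trans_lt h)).1.le

lemma geom_sum_le_natCast {r : ℝ} (hr0 : 0 ≤ r) (hr1 : r ≤ 1) (n : ℕ) :
    ∑ l ∈ Finset.range n, r ^ l ≤ n := by
  simpa using Finset.sum_le_card_nsmul (Finset.range n) _ 1 fun l _ => pow_le_one₀ hr0 hr1

lemma geom_sum_le_of_min_lt {n : ℕ} {r Q : ℝ} (hr0 : 0 ≤ r) (hr1 : r ≤ 1)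
    (h : min (n : ℝ≥0∞) (ENNReal.ofReal |1 - r|)⁻¹ < ENNReal.ofReal Q) :
    ∑ l ∈ Finset.range n, r ^ l ≤ Q := by
  refine le_of_min_natCast_inv_lt (geom_sum_le_natCast hr0 hr1 n) ?_ (abs_nonneg _) h
  rw [abs_of_nonneg (sub_nonneg.2 hr1), mul_comm, mul_neg_geom_sum]
  exact sub_le_self 1 (pow_nonneg hr0 n)

lemma inv_mul_geom_sum_inv_le_of_min_lt {n : ℕ} {r Q : ℝ} (hr : 1 ≤ r)
    (h : min (n : ℝ≥0∞) (ENNReal.ofReal |1 - r|)⁻¹ < ENNReal.ofReal Q) :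
    r⁻¹ * ∑ l ∈ Finset.range n, r⁻¹ ^ l ≤ Q := by
  have hr0 : 0 ≤ r⁻¹ := inv_nonneg.2 (zero_le_one.trans hr)
  have hr1 : r⁻¹ ≤ 1 := inv_le_one_of_one_le₀ hr
  have hsum := geom_sum_le_natCast hr0 hr1 n
  refine le_of_min_natCast_inv_lt ?_ ?_ (abs_nonneg _) h
  · exact (mul_le_of_le_one_left (Finset.sum_nonneg fun l _ => pow_nonneg hr0 l) hr1).trans hsum
  · have hfac : r⁻¹ * (r - 1) = 1 - r⁻¹ := by field_simp
    calc (r⁻¹ * ∑ l ∈ Finset.range n, r⁻¹ ^ l) * |1 - r|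
        = (1 - r⁻¹) * ∑ l ∈ Finset.range n, r⁻¹ ^ l := by
          rw [abs_of_nonpos (sub_nonpos.2 hr), neg_sub, mul_right_comm, hfac]
      _ = 1 - r⁻¹ ^ n := mul_neg_geom_sum _ _
      _ ≤ 1 := sub_le_self 1 (pow_nonneg hr0 n)

open Classical in
/-- The number of rows and columns to delete from a Jordan block of size `n` with eigenvalue of
modulus `x`: one if the block has a singular value that is negligible with respect to the noise
level `τ`, none otherwise. -/
noncomputable def deletion (n : ℕ) (x τ : ℝ) : ℕ :=
  if x < 1 ∧ x ^ n < n * τ then 1 else 0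

lemma inv_mul_geom_sum_inv_le_of_le_pow {n : ℕ} {x τ : ℝ} (hn : 0 < n) (hx0 : 0 < x) (hx1 : x ≤ 1)
    (hτ : 0 < τ) (h : n * τ ≤ x ^ n) :
    n * ((x ^ 2)⁻¹ * ∑ l ∈ Finset.range n, (x ^ 2)⁻¹ ^ l) ≤ (τ ^ 2)⁻¹ := by
  have hx2 : 1 ≤ (x ^ 2)⁻¹ := (one_le_inv₀ (by positivity)).2 (pow_le_one₀ hx0.le hx1)
  calc (n : ℝ) * ((x ^ 2)⁻¹ * ∑ l ∈ Finset.range n, (x ^ 2)⁻¹ ^ l)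
      = n * ∑ l ∈ Finset.range n, (x ^ 2)⁻¹ ^ (l + 1) := by simp_rw [Finset.mul_sum, pow_succ']
    _ ≤ n * (n * (x ^ 2)⁻¹ ^ n) := by
        gcongr
        refine (Finset.sum_le_card_nsmul (Finset.range n) _ ((x ^ 2)⁻¹ ^ n) fun l hl =>
          pow_le_pow_right₀ hx2 (Finset.mem_range.1 hl)).trans_eq ?_
        simp
    _ = n * (n * ((x ^ n) ^ 2)⁻¹) := by rw [inv_pow, pow_right_comm]
    _ ≤ n * (n * ((n * τ) ^ 2)⁻¹) := by gcongr
    _ = (τ ^ 2)⁻¹ := by field_simp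

lemma exists_truncatedBlock_mul_eq_one {n : ℕ} (hn : 0 < n) (w : ℂ) {Q τ : ℝ} (hQ : 0 ≤ Q)
    (hτ : 0 < τ)
    (h : min (n : ℝ≥0∞) (ENNReal.ofReal |1 - ‖w‖ ^ 2|)⁻¹ < ENNReal.ofReal Q) :
    ∃ X, truncatedBlock n (deletion n ‖w‖ τ) w * X = 1 ∧
      ∑ k, ∑ i, ‖X i k‖ ^ 2 ≤ n * Q + (τ ^ 2)⁻¹ := by
  have hτ2 : 0 ≤ (τ ^ 2)⁻¹ := by positivity
  by_cases hd : ‖w‖ < 1 ∧ ‖w‖ ^ n < n * τ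
  · rw [show deletion n ‖w‖ τ = 1 from if_pos hd]
    obtain ⟨X, hX, hXle⟩ := exists_truncatedBlock_one_mul_eq_one n w
    have hgeom := geom_sum_le_of_min_lt (by positivity) (pow_le_one₀ (norm_nonneg w) hd.1.le) h
    refine ⟨X, hX, hXle.trans ?_⟩
    exact (mul_le_mul_of_nonneg_left hgeom n.cast_nonneg).trans (le_add_of_nonneg_right hτ2)
  rw [show deletion n ‖w‖ τ = 0 from if_neg hd]
  rcases lt_or_ge ‖w‖ 1 with hw | hw
  · have hlarge : n * τ ≤ ‖w‖ ^ n := not_lt.1 fun hlt => hd ⟨hw, hlt⟩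
    have hw0 : 0 < ‖w‖ := by
      refine lt_of_pow_lt_pow_left₀ n (norm_nonneg w) ?_
      rw [zero_pow hn.ne']
      exact (by positivity : 0 < n * τ).trans_le hlarge
    obtain ⟨X, hX, hXle⟩ := exists_truncatedBlock_zero_mul_eq_one n (norm_pos_iff.1 hw0)
    refine ⟨X, hX, hXle.trans ?_⟩
    exact (inv_mul_geom_sum_inv_le_of_le_pow hn hw0 hw.le hτ hlarge).trans
      (le_add_of_nonneg_left (mul_nonneg n.cast_nonneg hQ))
  · obtain ⟨X, hX, hXle⟩ :=
      exists_truncatedBlock_zero_mul_eq_one n (norm_pos_iff.1 (zero_lt_one.trans_le hw))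
    have hgeom := inv_mul_geom_sum_inv_le_of_min_lt (one_le_pow₀ hw) h
    refine ⟨X, hX, hXle.trans ?_⟩
    exact (mul_le_mul_of_nonneg_left hgeom n.cast_nonneg).trans (le_add_of_nonneg_right hτ2)

end JordanBlocks

section PerturbedJordan

lemma sum_norm_sq_blockDiagonal' {K o : Type*} [NormedRing K] [Fintype o] [DecidableEq o]
    {m : o → Type*} [∀ i, Fintype (m i)] (X : ∀ i, Matrix (m i) (m i) K) :
    ∑ k, ∑ i, ‖Matrix.blockDiagonal' X i k‖ ^ 2 = ∑ l, ∑ k, ∑ i, ‖X l i k‖ ^ 2 := by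
  rw [Fintype.sum_sigma]
  refine Finset.sum_congr rfl fun l _ => Finset.sum_congr rfl fun k _ => ?_
  rw [Fintype.sum_sigma, Finset.sum_eq_single l]
  · simp only [Matrix.blockDiagonal'_apply_eq]
  · intro l' _ hl
    simp [Matrix.blockDiagonal'_apply_ne _ _ _ hl]
  · exact fun hl => absurd (Finset.mem_univ l) hl

lemma det_blockDiagonal' {R o : Type*} [CommRing R] [Fintype o] [LinearOrder o]
    {m : o → Type*} [∀ i, Fintype (m i)] [∀ i, DecidableEq (m i)]
    (A : ∀ i, Matrix (m i) (m i) R) :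
    (Matrix.blockDiagonal' A).det = ∏ i, (A i).det := by
  rw [(Matrix.blockTriangular_blockDiagonal' A).det_fintype]
  refine Finset.prod_congr rfl fun i _ => ?_
  rw [← Matrix.det_submatrix_equiv_self (Equiv.sigmaSubtype i).symm]
  congr 1
  ext x y
  simp [Matrix.toSquareBlock, Matrix.toSquareBlockProp, Equiv.sigmaSubtype,
    Matrix.blockDiagonal'_apply_eq]

variable {N : ℕ}

/-- The embedding of the truncated blocks into the index set of the full matrix, with a shift by
`e i` in the `i`-th block: no shift for the rows, a shift by `d i` for the columns. -/
def blockEmb (b : Composition N) (d e : Fin b.length → ℕ) (he : ∀ i, e i ≤ d i)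
    (p : Σ i, Fin (b.blocksFun i - d i)) : Fin N :=
  b.blocksFinEquiv ⟨p.1, ⟨p.2 + e p.1, Nat.add_lt_of_lt_sub (p.2.2.trans_le
    (Nat.sub_le_sub_left (he p.1) _))⟩⟩

lemma blockEmb_injective (b : Composition N) (d e : Fin b.length → ℕ) (he : ∀ i, e i ≤ d i) :
    Function.Injective (blockEmb b d e he) := by
  rintro ⟨i, j⟩ ⟨i', j'⟩ h
  obtain ⟨rfl, hj⟩ := Sigma.mk.inj (b.blocksFinEquiv.injective h)
  have hj' := Fin.mk.inj (eq_of_heq hj)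
  exact Sigma.ext rfl (heq_of_eq (Fin.ext (Nat.add_right_cancel hj')))

lemma jordanMatrix_sub_submatrix (b : Composition N) (c : Fin b.length → ℂ) (z : ℂ)
    (d : Fin b.length → ℕ) :
    (jordanMatrix b c - z • 1).submatrix
        (blockEmb b d (fun _ => 0) fun _ => Nat.zero_le _) (blockEmb b d d fun _ => le_rfl) =
      Matrix.blockDiagonal' fun i => truncatedBlock (b.blocksFun i) (d i) (c i - z) := by
  ext ⟨i, j⟩ ⟨i', j'⟩
  simp only [Matrix.submatrix_apply, Matrix.sub_apply, jordanMatrix, Matrix.reindex_apply, blockEmb,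
    Equiv.symm_apply_apply, Matrix.smul_apply, Matrix.one_apply, EmbeddingLike.apply_eq_iff_eq]
  by_cases hi : i = i'
  · subst hi
    simp only [Matrix.blockDiagonal'_apply_eq, jordanBlock, truncatedBlock, Matrix.of_apply,
      Sigma.mk.injEq, heq_eq_eq, true_and, Fin.mk.injEq, add_zero]
    by_cases hdiag : (j : ℕ) = j' + d i
    · simp [hdiag]
    · by_cases hsuper : (j : ℕ) + 1 = j' + d i <;> simp [hdiag, hsuper]
  · simp [Matrix.blockDiagonal'_apply_ne _ _ _ hi, hi]

lemma card_truncated_add_sum (b : Composition N) {d : Fin b.length → ℕ}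
    (hd : ∀ i, d i ≤ b.blocksFun i) :
    Fintype.card (Σ i, Fin (b.blocksFun i - d i)) + ∑ i, d i = N := by
  simp_rw [Fintype.card_sigma, Fintype.card_fin, ← Finset.sum_add_distrib,
    Nat.sub_add_cancel (hd _)]
  exact b.sum_blocksFun

/-- The number of rows and columns to delete from each block of `M - z`, at the noise level
`N ^ (1/2 - γ)` of an `N × N` Gaussian matrix with entries of size `N ^ (-γ)`. -/
noncomputable def blockDeletion (γ : ℝ) (b : Composition N) (c : Fin b.length → ℂ) (z : ℂ)
    (i : Fin b.length) : ℕ :=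
  deletion (b.blocksFun i) ‖c i - z‖ ((N : ℝ) ^ (1 / 2 - γ))

/-- The typical size of the dominant term in the expansion of `det (M - z + N ^ (-γ) G)`: the
determinants of the truncated blocks times that of an independent noise block of size `s`, where
`s` is the number of deleted rows. -/
noncomputable def dominantTerm (γ : ℝ) (b : Composition N) (c : Fin b.length → ℂ) (z : ℂ) : ℝ :=
  ((N : ℝ) ^ (-γ)) ^ (∑ i, blockDeletion γ b c z i) *
    (∏ i, ‖(truncatedBlock (b.blocksFun i) (blockDeletion γ b c z i) (c i - z)).det‖) *
    √(∑ i, blockDeletion γ b c z i).factorial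

variable {γ ε : ℝ} (b : Composition N) (c : Fin b.length → ℂ) {z : ℂ}

lemma deletion_le_one (n : ℕ) (x τ : ℝ) : deletion n x τ ≤ 1 := by
  unfold deletion
  split_ifs <;> decide

lemma sum_blockDeletion_le (γ : ℝ) (z : ℂ) : ∑ i, blockDeletion γ b c z i ≤ b.length := by
  simpa using Finset.sum_le_card_nsmul Finset.univ (blockDeletion γ b c z) 1
    fun i _ => deletion_le_one _ _ _

lemma exists_blockDiagonal'_truncatedBlock_mul_eq_one (hN : 0 < N) (hz : z ∈ stableSet γ ε b c) :
    ∃ X, (Matrix.blockDiagonal' fun i =>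
        truncatedBlock (b.blocksFun i) (blockDeletion γ b c z i) (c i - z)) * X = 1 ∧
      ((N : ℝ) ^ (-γ)) ^ 2 * ∑ k, ∑ i, ‖X i k‖ ^ 2 ≤ (N : ℝ) ^ (-ε) + b.length / N := by
  have hN' : (0 : ℝ) < N := by exact_mod_cast hN
  set Q : ℝ := (N : ℝ) ^ (2 * γ - 1 - ε)
  set τ : ℝ := (N : ℝ) ^ (1 / 2 - γ)
  have hblock (i : Fin b.length) : ∃ X,
      truncatedBlock (b.blocksFun i) (blockDeletion γ b c z i) (c i - z) * X = 1 ∧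
        ∑ k, ∑ j, ‖X j k‖ ^ 2 ≤ b.blocksFun i * Q + (τ ^ 2)⁻¹ :=
    exists_truncatedBlock_mul_eq_one (b.one_le_blocksFun i) (c i - z) (Real.rpow_nonneg hN'.le _)
      (Real.rpow_pos_of_pos hN' _) (norm_sub_rev z (c i) ▸ hz i)
  choose X hX hXle using hblock
  refine ⟨Matrix.blockDiagonal' X, ?_, ?_⟩
  · rw [← Matrix.blockDiagonal'_mul, ← Matrix.blockDiagonal'_one]
    exact congrArg _ (funext hX)
  have hsum : ∑ l, ∑ k, ∑ i, ‖X l i k‖ ^ 2 ≤ N * Q + b.length * (τ ^ 2)⁻¹ := by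
    refine (Finset.sum_le_sum fun l _ => hXle l).trans_eq ?_
    rw [Finset.sum_add_distrib, ← Finset.sum_mul, ← Nat.cast_sum, b.sum_blocksFun]
    simp
  have hQ : ((N : ℝ) ^ (-γ)) ^ 2 * (N * Q) = (N : ℝ) ^ (-ε) := by
    nth_rewrite 2 [← Real.rpow_one (N : ℝ)]
    rw [← Real.rpow_mul_natCast hN'.le, ← Real.rpow_add hN', ← Real.rpow_add hN']
    congr 1
    push_cast
    ring
  have hτ : ((N : ℝ) ^ (-γ)) ^ 2 * (τ ^ 2)⁻¹ = (N : ℝ)⁻¹ := by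
    rw [← Real.rpow_mul_natCast hN'.le, ← Real.rpow_mul_natCast hN'.le, ← Real.rpow_neg hN'.le,
      ← Real.rpow_add hN', ← Real.rpow_neg_one]
    congr 1
    push_cast
    ring
  rw [sum_norm_sq_blockDiagonal']
  refine (mul_le_mul_of_nonneg_left hsum (by positivity)).trans_eq ?_
  rw [mul_add, hQ, mul_left_comm, hτ, div_eq_mul_inv]

lemma IsStandardGaussianMatrix.measure_norm_det_perturbedMatrix_le {Ω : Type*} [MeasurableSpace Ω]
    {P : Measure Ω} [IsProbabilityMeasure P] {G : Ω → Matrix (Fin N) (Fin N) ℝ}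
    (hG : IsStandardGaussianMatrix P G)
    (hN : 0 < N) (hz : z ∈ stableSet γ ε b c) (hT : (N : ℝ) ^ (-ε) + b.length / N < 1)
    {θ : ℝ} (hθ : 0 < θ) :
    P {ω | ‖(perturbedMatrix γ (jordanMatrix b c) (G ω) - z • 1).det‖ ≤
        2⁻¹ * dominantTerm γ b c z * θ} ≤
      4 * ENNReal.ofReal (((N : ℝ) ^ (-ε) + b.length / N) /
        (1 - ((N : ℝ) ^ (-ε) + b.length / N))) +
        3 ^ b.length * ENNReal.ofReal (√θ) := by
  have hdel (i) : blockDeletion γ b c z i ≤ b.blocksFun i :=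
    (deletion_le_one _ _ _).trans (b.one_le_blocksFun i)
  have hsub := jordanMatrix_sub_submatrix b c z (blockDeletion γ b c z)
  obtain ⟨X, hX, hXle⟩ := exists_blockDiagonal'_truncatedBlock_mul_eq_one b c hN hz
  rw [← hsub] at hX
  have hball := hG.measure_norm_det_add_smul_le (jordanMatrix b c - z • 1)
    (Real.rpow_pos_of_pos (Nat.cast_pos.2 hN) (-γ)) (card_truncated_add_sum b hdel)
    (blockEmb_injective _ _ _ _) (blockEmb_injective _ _ _ _) hX hXle hT hθ
  rw [hsub, det_blockDiagonal', norm_prod] at hball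
  refine (le_of_eq ?_).trans (hball.trans ?_)
  · simp only [dominantTerm, perturbedMatrix, sub_add_eq_add_sub, mul_assoc]
  · gcongr
    · norm_num
    · exact sum_blockDeletion_le b c γ z

end PerturbedJordan

section LogarithmicPotentials

lemma log_enorm_of_ne_zero {w : ℂ} (hw : w ≠ 0) :
    ENNReal.log ‖w‖ₑ = ((Real.log ‖w‖ : ℝ) : EReal) := by
  rw [← ofReal_norm, ENNReal.log_ofReal_of_pos (norm_pos_iff.2 hw)]

lemma toENNReal_log_enorm (w : ℂ) :
    (ENNReal.log ‖w‖ₑ).toENNReal = ENNReal.ofReal (Real.log ‖w‖) := by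
  rcases eq_or_ne w 0 with rfl | hw
  · simp
  · rw [log_enorm_of_ne_zero hw]
    exact EReal.toENNReal_of_ne_top (EReal.coe_ne_top _)

lemma toENNReal_neg_log_enorm {w : ℂ} (hw : w ≠ 0) :
    (-ENNReal.log ‖w‖ₑ).toENNReal = ENNReal.ofReal (-Real.log ‖w‖) := by
  rw [log_enorm_of_ne_zero hw, ← EReal.coe_neg]
  exact EReal.toENNReal_of_ne_top (EReal.coe_ne_top _)

lemma coe_integral_eq_lintegral_sub {α : Type*} [MeasurableSpace α] {ρ : Measure α} {f : α → ℝ}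
    (hf : Integrable f ρ) :
    ((∫ x, f x ∂ρ : ℝ) : EReal) =
      ((∫⁻ x, ENNReal.ofReal (f x) ∂ρ : ℝ≥0∞) : EReal) -
        ((∫⁻ x, ENNReal.ofReal (-f x) ∂ρ : ℝ≥0∞) : EReal) := by
  rw [integral_eq_lintegral_pos_part_sub_lintegral_neg_part hf, EReal.coe_sub,
    EReal.coe_ennreal_toReal hf.lintegral_lt_top.ne]
  exact congrArg _ (EReal.coe_ennreal_toReal hf.neg.lintegral_lt_top.ne)

lemma logPotential_le_integral {ρ : Measure ℂ} {z : ℂ}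
    (h : Integrable (fun x => Real.log ‖z - x‖) ρ) :
    logPotential ρ z ≤ ((∫ x, Real.log ‖z - x‖ ∂ρ : ℝ) : EReal) := by
  rw [coe_integral_eq_lintegral_sub h, logPotential]
  simp_rw [toENNReal_log_enorm]
  refine EReal.sub_le_sub le_rfl (EReal.coe_ennreal_le_coe_ennreal_iff.2
    (lintegral_mono fun x => ?_))
  rcases eq_or_ne (z - x) 0 with hx | hx
  · simp [hx]
  · exact (toENNReal_neg_log_enorm hx).ge

lemma logPotential_eq_integral {ρ : Measure ℂ} {z : ℂ}
    (h : Integrable (fun x => Real.log ‖z - x‖) ρ) (hz : ∀ᵐ x ∂ρ, x ≠ z) :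
    logPotential ρ z = ((∫ x, Real.log ‖z - x‖ ∂ρ : ℝ) : EReal) := by
  rw [coe_integral_eq_lintegral_sub h, logPotential]
  simp_rw [toENNReal_log_enorm]
  congr 2
  refine lintegral_congr_ae ?_
  filter_upwards [hz] with x hx
  rw [toENNReal_neg_log_enorm (sub_ne_zero.2 hx.symm)]

section DiracSums

variable {α : Type*} [MeasurableSpace α] [MeasurableSingletonClass α] (s : Multiset α)

lemma integrable_multiset_sum_dirac (f : α → ℝ) :
    Integrable f (s.map fun w => Measure.dirac w).sum := by
  induction s using Multiset.induction_on with
  | empty => simp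
  | cons a s ih =>
    rw [Multiset.map_cons, Multiset.sum_cons]
    exact (integrable_dirac (by simp)).add_measure ih

lemma integral_multiset_sum_dirac (f : α → ℝ) :
    ∫ x, f x ∂(s.map fun w => Measure.dirac w).sum = (s.map f).sum := by
  induction s using Multiset.induction_on with
  | empty => simp
  | cons a s ih =>
    simp only [Multiset.map_cons, Multiset.sum_cons]
    rw [integral_add_measure (integrable_dirac (by simp)) (integrable_multiset_sum_dirac s f),
      ih, integral_dirac]

lemma ae_multiset_sum_dirac {p : α → Prop} (hp : ∀ w ∈ s, p w) :
    ∀ᵐ x ∂(s.map fun w => Measure.dirac w).sum, p x := by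
  induction s using Multiset.induction_on with
  | empty => simp
  | cons a s ih =>
    rw [Multiset.map_cons, Multiset.sum_cons, ae_add_measure_iff, ae_dirac_eq]
    exact ⟨hp a (Multiset.mem_cons_self a s), ih fun w hw => hp w (Multiset.mem_cons_of_mem hw)⟩

end DiracSums

lemma log_norm_multiset_prod {K : Type*} [NormedField K] (s : Multiset K) (hs : 0 ∉ s) :
    Real.log ‖s.prod‖ = (s.map fun w => Real.log ‖w‖).sum := by
  induction s using Multiset.induction_on with
  | empty => simp
  | cons a s ih =>
    rw [Multiset.mem_cons, not_or] at hs
    rw [Multiset.prod_cons, norm_mul, Real.log_mul (norm_ne_zero_iff.2 (Ne.symm hs.1))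
      (norm_ne_zero_iff.2 (Multiset.prod_ne_zero hs.2)), ih hs.2, Multiset.map_cons,
      Multiset.sum_cons]

lemma norm_det_sub_smul_one {n : Type*} [Fintype n] [DecidableEq n] (A : Matrix n n ℂ) (z : ℂ) :
    ‖(A - z • 1).det‖ = ‖(A.charpoly.roots.map fun w => z - w).prod‖ := by
  have heval : A.charpoly.eval z = (A.charpoly.roots.map fun w => z - w).prod := by
    conv_lhs => rw [(IsAlgClosed.splits A.charpoly).eq_prod_roots_of_monic A.charpoly_monic]
    rw [Polynomial.eval_multiset_prod, Multiset.map_map]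
    simp
  rw [← heval, Matrix.eval_charpoly, ← neg_sub, Matrix.det_neg, norm_mul, norm_pow, norm_neg,
    norm_one, one_pow, one_mul, Matrix.smul_one_eq_diagonal]
  rfl

lemma logPotential_empiricalSpectralMeasure {N : ℕ} (hN : N ≠ 0) (A : Matrix (Fin N) (Fin N) ℂ)
    {z : ℂ} (hdet : (A - z • 1).det ≠ 0) :
    logPotential (empiricalSpectralMeasure A) z =
      (((N : ℝ)⁻¹ * Real.log ‖(A - z • 1).det‖ : ℝ) : EReal) := by
  have hprod := norm_det_sub_smul_one A z
  have hzero : (0 : ℂ) ∉ A.charpoly.roots.map fun w => z - w := fun h =>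
    hdet (norm_eq_zero.1 (hprod.trans (by rw [Multiset.prod_eq_zero h, norm_zero])))
  have hroot : ∀ w ∈ A.charpoly.roots, w ≠ z := fun w hw hwz =>
    hzero (Multiset.mem_map.2 ⟨w, hw, sub_eq_zero.2 hwz.symm⟩)
  have hint := integrable_multiset_sum_dirac A.charpoly.roots fun x => Real.log ‖z - x‖
  rw [empiricalSpectralMeasure,
    logPotential_eq_integral (hint.smul_measure (ENNReal.inv_ne_top.2 (Nat.cast_ne_zero.2 hN)))
      (Measure.ae_smul_measure (ae_multiset_sum_dirac _ hroot) _),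
    integral_smul_measure, integral_multiset_sum_dirac, hprod, log_norm_multiset_prod _ hzero,
    ENNReal.toReal_inv, ENNReal.toReal_natCast, Multiset.map_map, smul_eq_mul]
  rfl

lemma integrable_log_uniformCircle (c z : ℂ) (r : ℝ) :
    Integrable (fun x => Real.log ‖z - x‖) (uniformCircle c r) := by
  have hcircle := circleIntegrable_log_norm_sub_const (a := z) (c := c) r
  rw [CircleIntegrable, intervalIntegrable_iff_integrableOn_Ioc_of_le Real.two_pi_pos.le] at hcircle
  simp_rw [norm_sub_rev _ z] at hcircle
  rw [uniformCircle, integrable_map_measure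
    (by fun_prop : Measurable fun x : ℂ => Real.log ‖z - x‖).aestronglyMeasurable
    (continuous_circleMap c r).aemeasurable]
  exact Integrable.smul_measure hcircle
    (ENNReal.inv_ne_top.2 (ENNReal.ofReal_pos.2 Real.two_pi_pos).ne')

lemma integral_log_uniformCircle (c z : ℂ) {r : ℝ} (hr : 0 < r) :
    ∫ x, Real.log ‖z - x‖ ∂(uniformCircle c r) = Real.log (max r ‖z - c‖) := by
  have haverage :=
    circleAverage_log_norm_sub_const_eq_log_radius_add_posLog (a := z) (c := c) hr.ne'
  rw [Real.circleAverage_def, intervalIntegral.integral_of_le Real.two_pi_pos.le,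
    Real.posLog_eq_log_max_one (by positivity), ← Real.log_mul hr.ne' (by positivity),
    mul_max_of_nonneg _ _ hr.le, mul_one, mul_inv_cancel_left₀ hr.ne'] at haverage
  simp_rw [norm_sub_rev _ z] at haverage
  rw [← haverage, uniformCircle, integral_map (continuous_circleMap c r).aemeasurable
    (by fun_prop : Measurable fun x : ℂ => Real.log ‖z - x‖).aestronglyMeasurable,
    integral_smul_measure, ENNReal.toReal_inv, ENNReal.toReal_ofReal Real.two_pi_pos.le]

variable {N : ℕ} {γ : ℝ} (b : Composition N) (c : Fin b.length → ℂ) {z : ℂ}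

lemma blockRadius_pow_blocksFun (hN : 1 < N) (γ : ℝ) (i : Fin b.length) :
    blockRadius γ b i ^ b.blocksFun i = (N : ℝ) ^ (1 / 2 - γ) := by
  have hlog : Real.log N ≠ 0 := (Real.log_pos (Nat.one_lt_cast.2 hN)).ne'
  have hn : (b.blocksFun i : ℝ) ≠ 0 :=
    Nat.cast_ne_zero.2 (Nat.one_le_iff_ne_zero.1 (b.one_le_blocksFun i))
  rw [blockRadius, blockRatio, ← Real.exp_nat_mul,
    Real.rpow_def_of_pos (Nat.cast_pos.2 (zero_lt_one.trans hN))]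
  congr 1
  field_simp
  ring

lemma logPotential_circleMixture_le (hN : 1 < N) (γ : ℝ) (z : ℂ) :
    logPotential (circleMixture γ b c) z ≤
      (((N : ℝ)⁻¹ * ∑ i, Real.log (max ((N : ℝ) ^ (1 / 2 - γ)) (‖c i - z‖ ^ b.blocksFun i)) : ℝ) :
        EReal) := by
  have hint (i : Fin b.length) : Integrable (fun x => Real.log ‖z - x‖)
      (((b.blocksFun i : ℝ≥0∞) / (N : ℝ≥0∞)) • uniformCircle (c i) (blockRadius γ b i)) :=
    (integrable_log_uniformCircle (c i) z _).smul_measure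
      (ENNReal.div_ne_top (ENNReal.natCast_ne_top _) (Nat.cast_ne_zero.2 (by omega)))
  refine (logPotential_le_integral (integrable_finsetSum_measure.2 fun i _ => hint i)).trans_eq ?_
  congr 1
  rw [integral_finsetSum_measure fun i _ => hint i, Finset.mul_sum]
  refine Finset.sum_congr rfl fun i _ => ?_
  have hr : 0 < blockRadius γ b i := Real.exp_pos _
  rw [integral_smul_measure, integral_log_uniformCircle (c i) z hr, ENNReal.toReal_div,
    ENNReal.toReal_natCast, ENNReal.toReal_natCast, smul_eq_mul, norm_sub_rev z,
    ← blockRadius_pow_blocksFun b hN γ i,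
    ← (pow_left_monotoneOn.map_max (Set.mem_ofPred.2 hr.le) (Set.mem_ofPred.2 (norm_nonneg _))),
    Real.log_pow]
  ring

lemma norm_det_le_of_logPotential_le (hN : 1 < N) {δ : ℝ} {A : Matrix (Fin N) (Fin N) ℂ}
    (h : logPotential (empiricalSpectralMeasure A) z ≤
      logPotential (circleMixture γ b c) z - (δ : EReal)) :
    ‖(A - z • 1).det‖ ≤ Real.exp (-(δ * N)) *
      ∏ i, max ((N : ℝ) ^ (1 / 2 - γ)) (‖c i - z‖ ^ b.blocksFun i) := by
  have hN' : (0 : ℝ) < N := Nat.cast_pos.2 (zero_lt_one.trans hN)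
  have hpos (i : Fin b.length) :
      0 < max ((N : ℝ) ^ (1 / 2 - γ)) (‖c i - z‖ ^ b.blocksFun i) :=
    lt_max_of_lt_left (by positivity)
  rcases eq_or_ne (A - z • 1).det 0 with hdet | hdet
  · rw [hdet, norm_zero]
    exact mul_nonneg (Real.exp_pos _).le (Finset.prod_nonneg fun i _ => (hpos i).le)
  rw [logPotential_empiricalSpectralMeasure (by omega) A hdet] at h
  have hlog := h.trans (EReal.sub_le_sub (logPotential_circleMixture_le b c hN γ z) le_rfl)
  rw [← EReal.coe_sub, EReal.coe_le_coe_iff, ← Real.log_prod fun i _ => (hpos i).ne',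
    inv_mul_le_iff₀ hN', mul_sub, mul_inv_cancel_left₀ hN'.ne'] at hlog
  calc ‖(A - z • 1).det‖ = Real.exp (Real.log ‖(A - z • 1).det‖) :=
        (Real.exp_log (norm_pos_iff.2 hdet)).symm
    _ ≤ Real.exp (-(δ * N) + Real.log _) := Real.exp_le_exp.2 (by linarith)
    _ = _ := by rw [Real.exp_add, Real.exp_log (Finset.prod_pos fun i _ => hpos i)]

end LogarithmicPotentials

section DominantTerm

lemma max_le_norm_det_truncatedBlock {n : ℕ} (hn : 0 < n) {τ : ℝ} (hτ0 : 0 < τ) (hτ1 : τ ≤ 1)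
    (w : ℂ) :
    max τ (‖w‖ ^ n) ≤ ‖(truncatedBlock n (deletion n ‖w‖ τ) w).det‖ *
      τ ^ deletion n ‖w‖ τ * (n : ℝ) ^ deletion n ‖w‖ τ := by
  have hτn : τ ≤ n * τ := le_mul_of_one_le_left hτ0.le (Nat.one_le_cast.2 hn)
  by_cases h : ‖w‖ < 1 ∧ ‖w‖ ^ n < n * τ
  · rw [show deletion n ‖w‖ τ = 1 from if_pos h, det_truncatedBlock_one, norm_one, one_mul,
      pow_one, pow_one, mul_comm τ]
    exact max_le hτn h.2.le
  · rw [show deletion n ‖w‖ τ = 0 from if_neg h, det_truncatedBlock_zero, norm_pow, pow_zero,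
      pow_zero, mul_one, mul_one]
    refine max_le ?_ le_rfl
    rcases lt_or_ge ‖w‖ 1 with hw | hw
    · exact hτn.trans (not_lt.1 fun hlt => h ⟨hw, hlt⟩)
    · exact hτ1.trans (one_le_pow₀ hw)

lemma natCast_pow_le_of_le_one {K : ℝ} (hK : 0 < K) (n : ℕ) {d : ℕ} (hd : d ≤ 1) :
    (n : ℝ) ^ d ≤ K ^ d * Real.exp (n / K) := by
  interval_cases d
  · simpa using (by positivity : (0 : ℝ) ≤ n / K)
  · have hexp : (n : ℝ) / K ≤ Real.exp (n / K) :=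
      (le_add_of_nonneg_right zero_le_one).trans (Real.add_one_le_exp _)
    simpa [mul_comm K] using (div_le_iff₀ hK).1 hexp

lemma sqrt_pow_le_sqrt_factorial {K x : ℝ} (hK : 1 ≤ K) (hx : 0 ≤ x) (s : ℕ) :
    √x ^ s ≤ √(s.factorial : ℝ) * K ^ s * Real.exp (x / K) := by
  have : 0 < K := zero_lt_one.trans_le hK
  have hexp := Real.pow_div_factorial_le_exp (x / K) (by positivity) s
  rw [div_le_iff₀ (by positivity), div_pow, div_le_iff₀ (by positivity)] at hexp
  refine le_of_sq_le_sq ?_ (by positivity)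
  calc (√x ^ s) ^ 2 = x ^ s := by rw [pow_right_comm, Real.sq_sqrt hx]
    _ ≤ Real.exp (x / K) * s.factorial * K ^ s := hexp
    _ = s.factorial * K ^ s * Real.exp (x / K) := by ring
    _ ≤ s.factorial * (K ^ s) ^ 2 * Real.exp (x / K) ^ 2 := by
        gcongr
        · exact le_self_pow₀ (one_le_pow₀ hK) two_ne_zero
        · exact le_self_pow₀ (Real.one_le_exp (by positivity)) two_ne_zero
    _ = (√(s.factorial : ℝ) * K ^ s * Real.exp (x / K)) ^ 2 := by
        rw [mul_pow, mul_pow, Real.sq_sqrt (Nat.cast_nonneg _)]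

variable {N : ℕ} {γ : ℝ} (b : Composition N) (c : Fin b.length → ℂ) (z : ℂ)

lemma prod_natCast_pow_blockDeletion_le (γ : ℝ) {K : ℝ} (hK : 0 < K) :
    ∏ i, (b.blocksFun i : ℝ) ^ blockDeletion γ b c z i ≤
      K ^ (∑ i, blockDeletion γ b c z i) * Real.exp (N / K) := by
  calc ∏ i, (b.blocksFun i : ℝ) ^ blockDeletion γ b c z i
      ≤ ∏ i, K ^ blockDeletion γ b c z i * Real.exp (b.blocksFun i / K) :=
        Finset.prod_le_prod (fun i _ => by positivity) fun i _ =>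
          natCast_pow_le_of_le_one hK _ (deletion_le_one _ _ _)
    _ = K ^ (∑ i, blockDeletion γ b c z i) * Real.exp (N / K) := by
        rw [Finset.prod_mul_distrib, Finset.prod_pow_eq_pow_sum, ← Real.exp_sum,
          ← Finset.sum_div, ← Nat.cast_sum, b.sum_blocksFun]

lemma prod_max_le_dominantTerm (hN : 0 < N) (hγ : 1 / 2 ≤ γ) {K : ℝ} (hK : 1 ≤ K) :
    ∏ i, max ((N : ℝ) ^ (1 / 2 - γ)) (‖c i - z‖ ^ b.blocksFun i) ≤
      dominantTerm γ b c z * ((K ^ 2) ^ b.length * Real.exp (2 * N / K)) := by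
  have hN' : (0 : ℝ) < N := Nat.cast_pos.2 hN
  set s := ∑ i, blockDeletion γ b c z i with hs
  set D := ∏ i, ‖(truncatedBlock (b.blocksFun i) (blockDeletion γ b c z i) (c i - z)).det‖
  have : 0 ≤ D := Finset.prod_nonneg fun i _ => norm_nonneg _
  have hblocks : ∏ i, max ((N : ℝ) ^ (1 / 2 - γ)) (‖c i - z‖ ^ b.blocksFun i) ≤
      D * ((N : ℝ) ^ (1 / 2 - γ)) ^ s * ∏ i, (b.blocksFun i : ℝ) ^ blockDeletion γ b c z i := by
    rw [hs, ← Finset.prod_pow_eq_pow_sum, ← Finset.prod_mul_distrib, ← Finset.prod_mul_distrib]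
    exact Finset.prod_le_prod (fun i _ => by positivity) fun i _ =>
      max_le_norm_det_truncatedBlock (b.one_le_blocksFun i) (by positivity)
        (Real.rpow_le_one_of_one_le_of_nonpos (Nat.one_le_cast.2 hN) (by linarith)) _
  have hτ : (N : ℝ) ^ (1 / 2 - γ) = (N : ℝ) ^ (-γ) * √(N : ℝ) := by
    rw [Real.sqrt_eq_rpow, ← Real.rpow_add hN']
    ring_nf
  calc _ ≤ D * ((N : ℝ) ^ (-γ) * √(N : ℝ)) ^ s * (K ^ s * Real.exp (N / K)) := by
        rw [← hτ]
        exact hblocks.trans (mul_le_mul_of_nonneg_left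
          (prod_natCast_pow_blockDeletion_le b c z γ (zero_lt_one.trans_le hK)) (by positivity))
    _ = ((N : ℝ) ^ (-γ)) ^ s * D * √(N : ℝ) ^ s * (K ^ s * Real.exp (N / K)) := by ring
    _ ≤ ((N : ℝ) ^ (-γ)) ^ s * D * (√(s.factorial : ℝ) * K ^ s * Real.exp (N / K)) *
          (K ^ s * Real.exp (N / K)) := by
        gcongr
        exact sqrt_pow_le_sqrt_factorial hK hN'.le s
    _ = dominantTerm γ b c z * ((K ^ 2) ^ s * Real.exp (2 * N / K)) := by
        rw [dominantTerm, mul_div_assoc, two_mul, Real.exp_add]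
        ring
    _ ≤ dominantTerm γ b c z * ((K ^ 2) ^ b.length * Real.exp (2 * N / K)) := by
        have hterm : 0 ≤ dominantTerm γ b c z := by rw [dominantTerm]; positivity
        gcongr
        · exact one_le_pow₀ hK
        · exact sum_blockDeletion_le b c γ z

lemma exp_mul_prod_max_le (hN : 0 < N) (hγ : 1 / 2 ≤ γ) {δ K : ℝ} (hK : 1 ≤ K)
    (hKδ : 8 / δ ≤ K) (hδ : 0 < δ) (hlarge : 2 * (K ^ 2) ^ b.length ≤ Real.exp (δ / 4 * N)) :
    Real.exp (-(δ * N)) * ∏ i, max ((N : ℝ) ^ (1 / 2 - γ)) (‖c i - z‖ ^ b.blocksFun i) ≤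
      2⁻¹ * dominantTerm γ b c z * Real.exp (-(δ / 2 * N)) := by
  have hterm : 0 ≤ dominantTerm γ b c z := by rw [dominantTerm]; positivity
  have hexp : 2 * N / K ≤ δ / 4 * N := by
    rw [div_le_iff₀ hδ] at hKδ
    rw [div_le_iff₀ (zero_lt_one.trans_le hK)]
    nlinarith [N.cast_nonneg (α := ℝ)]
  calc Real.exp (-(δ * N)) * ∏ i, max ((N : ℝ) ^ (1 / 2 - γ)) (‖c i - z‖ ^ b.blocksFun i)
      ≤ Real.exp (-(δ * N)) *
          (dominantTerm γ b c z * (2⁻¹ * Real.exp (δ / 4 * N) * Real.exp (δ / 4 * N))) := by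
        refine mul_le_mul_of_nonneg_left
          ((prod_max_le_dominantTerm b c z hN hγ hK).trans ?_) (Real.exp_pos _).le
        gcongr
        linarith
    _ = 2⁻¹ * dominantTerm γ b c z *
          (Real.exp (-(δ * N)) * Real.exp (δ / 4 * N) * Real.exp (δ / 4 * N)) := by ring
    _ = 2⁻¹ * dominantTerm γ b c z * Real.exp (-(δ / 2 * N)) := by
        rw [← Real.exp_add, ← Real.exp_add]
        ring_nf

end DominantTerm

section Asymptotics

lemma measure_logPotential_le {Ω : Type*} [MeasurableSpace Ω] {P : Measure Ω}
    [IsProbabilityMeasure P] {N : ℕ} {G : Ω → Matrix (Fin N) (Fin N) ℝ}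
    (hG : IsStandardGaussianMatrix P G) (hN : 1 < N) {γ ε δ K : ℝ} (hγ : 1 / 2 ≤ γ)
    {b : Composition N} {c : Fin b.length → ℂ} {z : ℂ} (hz : z ∈ stableSet γ ε b c)
    (hT : (N : ℝ) ^ (-ε) + b.length / N < 1) (hK : 1 ≤ K) (hKδ : 8 / δ ≤ K) (hδ : 0 < δ)
    (hlarge : 2 * (K ^ 2) ^ b.length ≤ Real.exp (δ / 4 * N)) :
    P {ω | logPotential (empiricalSpectralMeasure
          (perturbedMatrix γ (jordanMatrix b c) (G ω))) z ≤
        logPotential (circleMixture γ b c) z - (δ : EReal)} ≤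
      4 * ENNReal.ofReal (((N : ℝ) ^ (-ε) + b.length / N) /
        (1 - ((N : ℝ) ^ (-ε) + b.length / N))) +
        ENNReal.ofReal (3 ^ b.length * Real.exp (-(δ / 4 * N))) := by
  have hdet := hG.measure_norm_det_perturbedMatrix_le b c (zero_lt_one.trans hN) hz hT
    (Real.exp_pos (-(δ / 2 * N)))
  have hsqrt : √(Real.exp (-(δ / 2 * N))) = Real.exp (-(δ / 4 * N)) := by
    rw [← Real.exp_half]
    ring_nf
  rw [hsqrt] at hdet
  rw [ENNReal.ofReal_mul (by positivity), ENNReal.ofReal_pow zero_le_three, ENNReal.ofReal_ofNat]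
  exact (measure_mono fun ω hω => (norm_det_le_of_logPotential_le b c hN hω).trans
    (exp_mul_prod_max_le b c z (zero_lt_one.trans hN) hγ hK hKδ hδ hlarge)).trans hdet

variable {l : ℕ → ℕ}

lemma tendsto_pow_mul_exp_neg
    (hl : (fun N : ℕ => (l N : ℝ)) =o[atTop] fun N : ℕ => (N : ℝ))
    {K a : ℝ} (hK : 1 ≤ K) (ha : 0 < a) :
    Tendsto (fun N : ℕ => K ^ l N * Real.exp (-(a * N))) atTop (𝓝 0) := by
  have hlog : 0 ≤ Real.log K := Real.log_nonneg hK
  have hsmall := hl.def (show (0 : ℝ) < a / 2 / (Real.log K + 1) by positivity)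
  have hlim : Tendsto (fun N : ℕ => Real.exp (-(a / 2 * N))) atTop (𝓝 0) :=
    Real.tendsto_exp_neg_atTop_nhds_zero.comp
      (tendsto_natCast_atTop_atTop.const_mul_atTop (by positivity))
  refine squeeze_zero' (.of_forall fun N => by positivity) ?_ hlim
  filter_upwards [hsmall] with N hN
  rw [Real.norm_of_nonneg (Nat.cast_nonneg _), Real.norm_of_nonneg (Nat.cast_nonneg _),
    div_mul_eq_mul_div, le_div_iff₀ (by positivity)] at hN
  have hexp : K ^ l N = Real.exp (l N * Real.log K) := by
    rw [Real.exp_nat_mul, Real.exp_log (zero_lt_one.trans_le hK)]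
  rw [hexp, ← Real.exp_add, Real.exp_le_exp]
  linarith [(l N).cast_nonneg (α := ℝ)]

lemma eventually_two_mul_pow_le_exp
    (hl : (fun N : ℕ => (l N : ℝ)) =o[atTop] fun N : ℕ => (N : ℝ))
    {K a : ℝ} (hK : 1 ≤ K) (ha : 0 < a) :
    ∀ᶠ N : ℕ in atTop, 2 * K ^ l N ≤ Real.exp (a * N) := by
  filter_upwards [(tendsto_pow_mul_exp_neg hl hK ha).eventually_lt_const
    (show (0 : ℝ) < 2⁻¹ by norm_num)] with N hN
  rw [Real.exp_neg, ← div_eq_mul_inv, div_lt_iff₀ (Real.exp_pos _)] at hN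
  linarith

lemma tendsto_rpow_neg_add_div
    (hl : (fun N : ℕ => (l N : ℝ)) =o[atTop] fun N : ℕ => (N : ℝ))
    {ε : ℝ} (hε : 0 < ε) :
    Tendsto (fun N : ℕ => (N : ℝ) ^ (-ε) + l N / N) atTop (𝓝 0) := by
  simpa using ((tendsto_rpow_neg_atTop hε).comp tendsto_natCast_atTop_atTop).add
    hl.tendsto_div_nhds_zero

lemma tendsto_probability_bound
    (hl : (fun N : ℕ => (l N : ℝ)) =o[atTop] fun N : ℕ => (N : ℝ))
    {ε a : ℝ} (hε : 0 < ε) (ha : 0 < a) :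
    Tendsto (fun N : ℕ =>
      4 * ENNReal.ofReal (((N : ℝ) ^ (-ε) + l N / N) / (1 - ((N : ℝ) ^ (-ε) + l N / N))) +
        ENNReal.ofReal (3 ^ l N * Real.exp (-(a * N)))) atTop (𝓝 0) := by
  have hT := tendsto_rpow_neg_add_div hl hε
  have hratio := hT.div (hT.const_sub 1) (by norm_num)
  have hexp := tendsto_pow_mul_exp_neg hl (K := 3) (by norm_num) ha
  simpa using (ENNReal.Tendsto.const_mul (ENNReal.tendsto_ofReal hratio)
    (.inr ENNReal.ofNat_ne_top)).add (ENNReal.tendsto_ofReal hexp)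

end Asymptotics

theorem proposition4p1 {Ω : Type*} [MeasurableSpace Ω] (P : Measure Ω) [IsProbabilityMeasure P]
    (γ ε : ℝ) (hγ : 1 / 2 < γ) (hε : 0 < ε) (hεγ : ε < 2 * γ - 1)
    (b : (N : ℕ) → Composition N) (c : (N : ℕ) → Fin (b N).length → ℂ)
    (hℓ : (fun N : ℕ => ((b N).length : ℝ)) =o[atTop] fun N : ℕ => (N : ℝ))
    (G : (N : ℕ) → Ω → Matrix (Fin N) (Fin N) ℝ)
    (hG : ∀ N, IsStandardGaussianMatrix P (G N))
    (z : ℕ → ℂ) (hz : ∀ᶠ N in atTop, z N ∈ stableSet γ ε (b N) (c N))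
    (δ : ℝ) (hδ : 0 < δ) :
    Tendsto
      (fun N : ℕ => P {ω |
        logPotential
            (empiricalSpectralMeasure
              (perturbedMatrix γ (jordanMatrix (b N) (c N)) (G N ω))) (z N) ≤
          logPotential (circleMixture γ (b N) (c N)) (z N) - (δ : EReal)})
      atTop (𝓝 0) := by
  have hδ' : 0 < δ / 4 := by positivity
  have hK : 1 ≤ max 1 (8 / δ) := le_max_left _ _
  have hsmall := (tendsto_rpow_neg_add_div hℓ hε).eventually_lt_const zero_lt_one
  have hlarge := eventually_two_mul_pow_le_exp hℓ (one_le_pow₀ (n := 2) hK) hδ'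
  refine tendsto_of_tendsto_of_tendsto_of_le_of_le' tendsto_const_nhds
    (tendsto_probability_bound hℓ hε hδ') (.of_forall fun _ => zero_le) ?_
  filter_upwards [hz, hsmall, hlarge, eventually_gt_atTop 1] with N hzN hsmallN hlargeN hN
  exact measure_logPotential_le (hG N) hN hγ.le hzN hsmallN hK (le_max_right _ _) hδ hlargeN
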